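/- Let $H\in(0,1)$ and $\kappa>0$. Put $c_{1,H}=\frac{1}{2\pi}\Gamma(2H+1)\sin(H\pi)$ and write $\mathcal F\phi(s,\xi)=\int_{\mathbb R}e^{-i\xi y}\phi(s,y)\,dy$ for the Fourier transform in space. Let $W=\{W(\phi):\phi\in C_c^\infty((0,\infty)\times\mathbb R)\}$ be a centered Gaussian family on a probability space $(\Omega,\mathcal F,\mathbb P)$ (noise that is white in time and fractional in space with Hurst parameter $H$) with covariance $$\mathbb E[W(\phi)W(\psi)]=c_{1,H}\int_0^\infty\!\!\int_{\mathbb R}\mathcal F\phi(s,\xi)\,\overline{\mathcal F\psi(s,\xi)}\,|\xi|^{1-2H}\,d\xi\,ds .$$ Let $\int\!\!\int g\,dW$ denote the Wiener integral, i.e. the extension of $\phi\mapsto W(\phi)$ by $L^2(\mathbb P)$-continuity to deterministic integrands $g$ that are limits of test functions in the norm given by this covariance. Let $p_t(x)=(2\pi\kappa t)^{-1/2}e^{-x^2/(2\kappa t)}$, and let $u=\{u_t(x):t\ge0,\ x\in\mathbb R\}$ be the stochastic convolution $$u_t(x)=\int_0^t\int_{\mathbb R}p_{t-s}(x-y)\,W(ds,dy)\quad\text{a.s.,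 for every }t\ge 0,\ x\in\mathbb R,$$ that is, the solution of $\partial_t u=\frac{\kappa}{2}\partial_x^2u+\dot W$ with $u_0=0$. A fractional Brownian motion (fBm) with Hurst parameter $h\in(0,1)$, indexed by $[0,\infty)$ or (two-sided) by $\mathbb R$, is a centered Gaussian process $X$ with $X_0=0$ a.s. and $\mathbb E|X_t-X_s|^2=|t-s|^{2h}$ for all $s,t$. (a) For every $x\in\mathbb R$ there exists an fBm $\{X_t\}_{t\ge0}$ with Hurst parameter $H/2$ such that $$u_t(x)-C_{1,H,\kappa}X_t,\quad t\ge0,\qquad C_{1,H,\kappa}:=\left(\frac{2^{1-H}\,\Gamma(2H)}{\kappa^{1-H}\,\Gamma(H)}\right)^{1/2},$$ is a mean-zero Gaussian process that has a version that is continuous on $[0,\infty)$ and infinitely differentiable on $(0,\infty)$. (b) For every $t>0$ there exists a two-sided fBm $\{B(x)\}_{x\in\mathbb R}$ with Hurst parameter $H$ such that $$u_t(x)-\kappa^{-1/2}B(x),\quad x\in\mathbb R,$$ is a Gaussian random field that has a version that is continuous and infinitely differentiable on $\mathbb R$. -/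

import Mathlib

open MeasureTheory ProbabilityTheory Filter Topology Set
open scoped NNReal ENNReal Distributions

noncomputable section

namespace FracHeat

/-- The open half plane `(0, ∞) × ℝ` of time-space points `(s, y)`. -/
def halfPlane : TopologicalSpace.Opens (ℝ × ℝ) :=
  ⟨Ioi 0 ×ˢ univ, isOpen_Ioi.prod isOpen_univ⟩

/-- The Fourier transform in the space variable only,
`(s, ξ) ↦ ∫ e^{-i ξ y} g(s, y) dy`. -/
def spaceFourier (g : ℝ × ℝ → ℝ) (p : ℝ × ℝ) : ℂ :=
  ∫ y : ℝ, Complex.exp (-(Complex.I * (p.2 : ℂ) * (y : ℂ))) * (g (p.1, y) : ℂ)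

/-- The constant `c_{1,H} = Γ(2H+1) sin(Hπ) / (2π)`. -/
def c1 (H : ℝ) : ℝ := 1 / (2 * Real.pi) * Real.Gamma (2 * H + 1) * Real.sin (H * Real.pi)

/-- The measure `c_{1,H} |ξ|^{1-2H} ds dξ` on `(0, ∞) × ℝ`. -/
def noiseMeasure (H : ℝ) : Measure (ℝ × ℝ) :=
  (volume.restrict (Ioi (0 : ℝ))).prod
    ((volume : Measure ℝ).withDensity (fun ξ => ENNReal.ofReal (c1 H * |ξ| ^ (1 - 2 * H))))

variable {Ω : Type*} [MeasurableSpace Ω]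

/-- Gaussian noise, white in time and fractional in space with Hurst parameter `H`:
a centred Gaussian family indexed by the test functions on `(0, ∞) × ℝ` with
`E[W(φ) W(ψ)] = c_{1,H} ∫ 𝓕φ(s, ξ) conj(𝓕ψ(s, ξ)) |ξ|^{1-2H} ds dξ`. -/
structure IsFractionalNoise (H : ℝ) (W : 𝓓(halfPlane, ℝ) → Ω → ℝ) (P : Measure Ω) : Prop where
  gaussian : IsGaussianProcess W P
  mean_zero : ∀ φ, ∫ ω, W φ ω ∂P = 0
  covariance : ∀ φ ψ, ((∫ ω, W φ ω * W ψ ω ∂P : ℝ) : ℂ) =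
    ∫ p, spaceFourier φ p * (starRingEnd ℂ) (spaceFourier ψ p) ∂(noiseMeasure H)

/-- `Y` is (a version of) the Wiener integral `∫∫ g(s, y) W(ds, dy)` of the deterministic
integrand `g`: the `L²(P)`-limit of `W(φ n)` for test functions `φ n` that converge to `g` in
the Hilbert norm `(c_{1,H} ∫ |𝓕(·)(s, ξ)|² |ξ|^{1-2H} ds dξ)^{1/2}` of the noise. -/
def IsWienerIntegral (H : ℝ) (W : 𝓓(halfPlane, ℝ) → Ω → ℝ) (P : Measure Ω)
    (g : ℝ × ℝ → ℝ) (Y : Ω → ℝ) : Prop :=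
  (∀ s : ℝ, Integrable (fun y => g (s, y))) ∧
  MemLp (spaceFourier g) 2 (noiseMeasure H) ∧
  MemLp Y 2 P ∧
  ∃ φ : ℕ → 𝓓(halfPlane, ℝ),
    Tendsto (fun n => eLpNorm (fun p => spaceFourier (φ n) p - spaceFourier g p) 2
      (noiseMeasure H)) atTop (𝓝 0) ∧
    Tendsto (fun n => eLpNorm (fun ω => W (φ n) ω - Y ω) 2 P) atTop (𝓝 0)

/-- The heat kernel of `(κ/2) ∂²/∂x²`. -/
def heatKernel (κ t x : ℝ) : ℝ :=
  1 / Real.sqrt (2 * Real.pi * κ * t) * Real.exp (-(x ^ 2 / (2 * κ * t)))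

/-- The integrand `(s, y) ↦ 1_{s < t} p_{t-s}(x - y)`. -/
def convKernel (κ t x : ℝ) (p : ℝ × ℝ) : ℝ :=
  if p.1 < t then heatKernel κ (t - p.1) (x - p.2) else 0

/-- `u` is the stochastic convolution
`u t x = ∫_0^t ∫ p_{t-s}(x - y) W(ds, dy)` a.s., for all `t ≥ 0` and `x ∈ ℝ`. -/
def IsStochasticConvolution (H κ : ℝ) (W : 𝓓(halfPlane, ℝ) → Ω → ℝ) (P : Measure Ω)
    (u : ℝ≥0 → ℝ → Ω → ℝ) : Prop :=
  ∀ (t : ℝ≥0) (x : ℝ), IsWienerIntegral H W P (convKernel κ t x) (u t x)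

/-- Fractional Brownian motion `{X_t}_{t ≥ 0}` with Hurst parameter `h`. -/
structure IsFBM (h : ℝ) (X : ℝ≥0 → Ω → ℝ) (P : Measure Ω) : Prop where
  gaussian : IsGaussianProcess X P
  mean_zero : ∀ t, ∫ ω, X t ω ∂P = 0
  zero : ∀ᵐ ω ∂P, X 0 ω = 0
  increments : ∀ s t, ∫ ω, |X t ω - X s ω| ^ 2 ∂P = |(t : ℝ) - (s : ℝ)| ^ (2 * h)

/-- Two-sided fractional Brownian motion `{B(x)}_{x ∈ ℝ}` with Hurst parameter `h`. -/
structure IsTwoSidedFBM (h : ℝ) (B : ℝ → Ω → ℝ) (P : Measure Ω) : Prop where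
  gaussian : IsGaussianProcess B P
  mean_zero : ∀ x, ∫ ω, B x ω ∂P = 0
  zero : ∀ᵐ ω ∂P, B 0 ω = 0
  increments : ∀ x y, ∫ ω, |B x ω - B y ω| ^ 2 ∂P = |x - y| ^ (2 * h)

/-- The constant `C_{1,H,κ} = (2^{1-H} Γ(2H) / (κ^{1-H} Γ(H)))^{1/2}`. -/
def C1 (H κ : ℝ) : ℝ :=
  Real.sqrt ((2 : ℝ) ^ (1 - H) * Real.Gamma (2 * H) / (κ ^ (1 - H) * Real.Gamma H))

end FracHeat

end

/-! At a fixed point `x`, the covariance of `u` is `covConst H κ * ((t + r) ^ H - |t - r| ^ H)`,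
whereas fBm of index H/2 has covariance (t^H + r^H - |t - r|^H)/2. The difference is a multiple of
t^H + r^H - (t + r)^H, which is itself the covariance of a Gaussian process, smooth away from 0.
Adding an independent copy Y of that process to `u` gives C1 times an fBm, and the remainder in (a)
is -Y.

At a fixed time, the increments of `u` have spectral density c1/κ |ξ|^(-1-2H) (1 - e^(-κtξ²)), and
those of κ^(-1/2) fBm have c1/κ |ξ|^(-1-2H). The missing part c1/κ |ξ|^(-1-2H) e^(-κtξ²) decays like
a Gaussian, so a field with this spectrum has entire sample paths. Again it is added as an
independent term.

The probability space is given, so the corrections have to be built from the noise itself. The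
closed span of `W` in L²(P) consists of jointly Gaussian variables
(`isGaussianProcess_of_mem_gaussianSpace`), so orthogonality there is independence. It contains
infinitely many orthonormal vectors orthogonal to the observed part of `u`
(`exists_orthonormal_seq_time`, `exists_orthonormal_seq_space`): at a fixed point because values at
a neighbouring point bring new information, at a fixed time because later noise is independent.

Smooth versions come from random power series (`exists_randomPowerSeries`). In space
(`exists_spaceCorrection`) a real version of e^(ixξ) - 1 is expanded in powers of x. In time
(`exists_timeProcess`) the correction is the primitive of a process with covariance (r +
s)^(-(2-H)), which the Cayley transform turns into a binomial series (`hasSum_cayley`). The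
constants match through `integral_one_sub_cos_mul_abs_rpow` and `C1_sq`. -/

namespace FracHeat

/-! ### Gaussian Hilbert space of a centred Gaussian process. -/

section GaussianSpace

variable {Ω ι : Type*} [MeasurableSpace Ω] {P : Measure Ω}

/-- The closed linear span in `L²(P)` of a family of random variables. -/
noncomputable def gaussianSpace (X : ι → Ω → ℝ) (P : Measure Ω) : Submodule ℝ (Lp ℝ 2 P) :=
  (Submodule.span ℝ {Y : Lp ℝ 2 P | ∃ i, Y =ᵐ[P] X i}).topologicalClosure

lemma isClosed_gaussianSpace (X : ι → Ω → ℝ) :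
    IsClosed (gaussianSpace X P : Set (Lp ℝ 2 P)) :=
  Submodule.isClosed_topologicalClosure _

lemma integral_mul_eq_inner (f g : Lp ℝ 2 P) : ∫ ω, f ω * g ω ∂P = inner ℝ f g := by
  rw [L2.inner_def]
  refine integral_congr_ae (Eventually.of_forall fun ω => ?_)
  simp [mul_comm]

lemma integral_sq_eq_norm_sq (f : Lp ℝ 2 P) : ∫ ω, f ω ^ 2 ∂P = ‖f‖ ^ 2 := by
  rw [← real_inner_self_eq_norm_sq, ← integral_mul_eq_inner]
  simp [sq]

variable [IsProbabilityMeasure P]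

lemma tendsto_integral_Lp {f : ℕ → Lp ℝ 2 P} {g : Lp ℝ 2 P} (h : Tendsto f atTop (𝓝 g)) :
    Tendsto (fun n => ∫ ω, f n ω ∂P) atTop (𝓝 (∫ ω, g ω ∂P)) := by
  have key : ∀ k : Lp ℝ 2 P, ∫ ω, k ω ∂P
      = inner ℝ ((memLp_const (1 : ℝ)).toLp (fun _ : Ω => (1 : ℝ)) : Lp ℝ 2 P) k := by
    intro k
    rw [← integral_mul_eq_inner]
    refine integral_congr_ae ?_
    filter_upwards [(memLp_const (μ := P) (p := 2) (1 : ℝ)).coeFn_toLp] with ω hω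
    rw [hω, one_mul]
  simp only [key]
  exact (continuous_const.inner continuous_id).continuousAt.tendsto.comp h

/-- A subsequence is all that is needed: it only serves to identify the characteristic function of
an L² limit. -/
lemma tendsto_integral_cexp_Lp {f : ℕ → Lp ℝ 2 P} {g : Lp ℝ 2 P} (h : Tendsto f atTop (𝓝 g))
    (t : ℝ) : ∃ ns : ℕ → ℕ, StrictMono ns ∧
      Tendsto (fun n => ∫ ω, Complex.exp (t * f (ns n) ω * Complex.I) ∂P) atTop
        (𝓝 (∫ ω, Complex.exp (t * g ω * Complex.I) ∂P)) := by
  obtain ⟨ns, hns, hlim⟩ := (tendstoInMeasure_of_tendsto_Lp h).exists_seq_tendsto_ae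
  refine ⟨ns, hns, ?_⟩
  refine tendsto_integral_of_dominated_convergence (fun _ => 1) ?_ (integrable_const _) ?_ ?_
  · intro n
    have := (Lp.aestronglyMeasurable (f (ns n))).aemeasurable
    exact (by fun_prop : AEMeasurable _ P).aestronglyMeasurable
  · intro n
    refine Eventually.of_forall fun ω => ?_
    rw [← Complex.ofReal_mul, Complex.norm_exp_ofReal_mul_I]
  · filter_upwards [hlim] with ω hω
    have : Continuous fun x : ℝ => Complex.exp (t * x * Complex.I) := by fun_prop
    exact (this.tendsto _).comp hω

variable {X : ι → Ω → ℝ}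

omit [IsProbabilityMeasure P] in
lemma charFun_of_mem_span (hX : IsGaussianProcess X P) (h0 : ∀ i, ∫ ω, X i ω ∂P = 0)
    {Y : Lp ℝ 2 P} (hY : Y ∈ Submodule.span ℝ {Y : Lp ℝ 2 P | ∃ i, Y =ᵐ[P] X i}) (t : ℝ) :
    ∫ ω, Complex.exp (t * Y ω * Complex.I) ∂P = Complex.exp (-(t ^ 2 * ‖Y‖ ^ 2 / 2 : ℝ)) := by
  obtain ⟨c, hc⟩ := (Finsupp.mem_span_iff_linearCombination ℝ _ Y).1 hY
  choose idx hidx using fun z : {Y : Lp ℝ 2 P | ∃ i, Y =ᵐ[P] X i} => z.2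
  have hYae : Y =ᵐ[P] fun ω => ∑ z ∈ c.support, c z * X (idx z) ω := by
    rw [← hc, Finsupp.linearCombination_apply, Finsupp.sum]
    have h1 : ∀ᵐ ω ∂P, ∀ z ∈ c.support,
        (c z • (z : Lp ℝ 2 P) : Lp ℝ 2 P) ω = c z * X (idx z) ω := by
      refine (Filter.eventually_all_finset c.support).2 ?_
      intro z _
      filter_upwards [Lp.coeFn_smul (c z) (z : Lp ℝ 2 P), hidx z] with ω h1 h2
      rw [h1, Pi.smul_apply, h2, smul_eq_mul]
    filter_upwards [Lp.coeFn_fun_finsetSum c.support fun z => c z • (z : Lp ℝ 2 P), h1]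
      with ω hω h1
    rw [hω]
    exact Finset.sum_congr rfl h1
  have hG : IsGaussianProcess (fun z ω => c z * X (idx z) ω) P :=
    (hX.comp_right idx).smul (fun z => c z)
  have hlaw := (hG.hasGaussianLaw_fun_sum (I := c.support)).congr hYae.symm
  have hmean : ∫ ω, Y ω ∂P = 0 := by
    rw [integral_congr_ae hYae, integral_finsetSum]
    · simp [integral_const_mul, h0]
    · intro z _
      exact ((hX.hasGaussianLaw_eval _).integrable).const_mul _
  have hvar : Var[Y; P] = ‖Y‖ ^ 2 := by
    rw [variance_of_integral_eq_zero hlaw.aemeasurable hmean, ← integral_sq_eq_norm_sq]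
  have := hlaw.charFun_map_eq t
  rw [charFun_apply_real, integral_map hlaw.aemeasurable (by fun_prop)] at this
  rw [this]
  have e1 : ∫ ω, inner ℝ t (Y ω) ∂P = 0 := by
    simp [integral_mul_const, hmean]
  have e2 : Var[fun ω => inner ℝ t (Y ω); P] = t ^ 2 * ‖Y‖ ^ 2 := by
    rw [← hvar, ← variance_const_mul]
    simp [mul_comm]
  rw [e1, e2]
  congr 1
  push_cast
  ring

/-- The formula involves `Y` only through its L² norm, so it passes from the span to its closure. -/
lemma charFun_of_mem_gaussianSpace (hX : IsGaussianProcess X P) (h0 : ∀ i, ∫ ω, X i ω ∂P = 0)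
    {Y : Lp ℝ 2 P} (hY : Y ∈ gaussianSpace X P) (t : ℝ) :
    ∫ ω, Complex.exp (t * Y ω * Complex.I) ∂P = Complex.exp (-(t ^ 2 * ‖Y‖ ^ 2 / 2 : ℝ)) := by
  obtain ⟨f, hf, hlim⟩ := mem_closure_iff_seq_limit.1 hY
  obtain ⟨ns, hns, h1⟩ := tendsto_integral_cexp_Lp hlim t
  refine tendsto_nhds_unique h1 ?_
  simp only [fun n => charFun_of_mem_span hX h0 (hf (ns n)) t]
  have : Continuous fun Z : Lp ℝ 2 P => Complex.exp (-(t ^ 2 * ‖Z‖ ^ 2 / 2 : ℝ)) := by fun_prop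
  exact (this.tendsto _).comp (hlim.comp hns.tendsto_atTop)

lemma integral_eq_zero_of_mem_gaussianSpace (h0 : ∀ i, ∫ ω, X i ω ∂P = 0)
    {Y : Lp ℝ 2 P} (hY : Y ∈ gaussianSpace X P) :
    ∫ ω, Y ω ∂P = 0 := by
  have hspan : ∀ Z ∈ Submodule.span ℝ {Y : Lp ℝ 2 P | ∃ i, Y =ᵐ[P] X i}, ∫ ω, Z ω ∂P = 0 := by
    intro Z hZ
    induction hZ using Submodule.span_induction with
    | mem Z h =>
      obtain ⟨i, hi⟩ := h
      rw [integral_congr_ae hi, h0]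
    | zero => rw [integral_congr_ae (Lp.coeFn_zero _ _ _)]; simp
    | add x y _ _ hx hy =>
      rw [integral_congr_ae (Lp.coeFn_add x y)]
      simp only [Pi.add_apply]
      rw [integral_add ((Lp.memLp x).integrable one_le_two) ((Lp.memLp y).integrable one_le_two),
        hx, hy, add_zero]
    | smul a x _ hx =>
      rw [integral_congr_ae (Lp.coeFn_smul a x)]
      simp [integral_const_mul, hx]
  obtain ⟨f, hf, hlim⟩ := mem_closure_iff_seq_limit.1 hY
  refine tendsto_nhds_unique (tendsto_integral_Lp hlim) ?_
  simp [fun n => hspan (f n) (hf n)]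

lemma hasGaussianLaw_of_mem_gaussianSpace (hX : IsGaussianProcess X P)
    (h0 : ∀ i, ∫ ω, X i ω ∂P = 0)
    {Y : Lp ℝ 2 P} (hY : Y ∈ gaussianSpace X P) :
    HasGaussianLaw Y P := by
  have hm : AEMeasurable Y P := (Lp.aestronglyMeasurable Y).aemeasurable
  suffices h : P.map Y = gaussianReal 0 (‖Y‖₊ ^ 2) by
    refine ⟨?_⟩
    rw [h]
    infer_instance
  have := Measure.isProbabilityMeasure_map hm
  refine Measure.ext_of_charFun (funext fun t => ?_)
  rw [charFun_apply_real, integral_map hm (by fun_prop), charFun_of_mem_gaussianSpace hX h0 hY,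
    charFun_gaussianReal]
  congr 1
  push_cast
  ring

/-- Cramér–Wold: a linear functional of finitely many elements of the Gaussian space lies in that
space again, hence is Gaussian. -/
lemma isGaussianProcess_of_mem_gaussianSpace (hX : IsGaussianProcess X P)
    (h0 : ∀ i, ∫ ω, X i ω ∂P = 0) {T : Type*} {Z : T → Ω → ℝ} (Y : T → Lp ℝ 2 P)
    (hY : ∀ t, Y t ∈ gaussianSpace X P) (hZ : ∀ t, Y t =ᵐ[P] Z t) : IsGaussianProcess Z P := by
  classical
  refine IsGaussianProcess.congr (X := fun t => (Y t : Ω → ℝ)) ⟨fun I => ⟨?_⟩⟩ hZ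
  have hm : AEMeasurable (fun ω => I.restrict (fun t => Y t ω)) P :=
    aemeasurable_pi_lambda _ fun i => (Lp.aestronglyMeasurable (Y i)).aemeasurable
  refine isGaussian_of_isGaussian_map fun L => ?_
  rw [AEMeasurable.map_map_of_aemeasurable L.continuous.measurable.aemeasurable hm]
  refine HasGaussianLaw.isGaussian_map (X := L ∘ fun ω => I.restrict (fun t => Y t ω)) ?_
  have hmem : ∑ i : I, L (Pi.single i 1) • Y i ∈ gaussianSpace X P :=
    Submodule.sum_mem _ fun i _ => Submodule.smul_mem _ _ (hY i)
  refine (hasGaussianLaw_of_mem_gaussianSpace hX h0 hmem).congr ?_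
  have h1 : ∀ᵐ ω ∂P, ∀ i : I, (L (Pi.single i 1) • Y i : Lp ℝ 2 P) ω
      = L (Pi.single i 1) * Y i ω := by
    rw [ae_all_iff]
    intro i
    filter_upwards [Lp.coeFn_smul (L (Pi.single i 1)) (Y i)] with ω hω
    rw [hω]; rfl
  filter_upwards [Lp.coeFn_fun_finsetSum Finset.univ fun i : I => L (Pi.single i 1) • Y i, h1]
    with ω hω h1
  rw [hω, Function.comp_apply]
  conv_rhs => rw [pi_eq_sum_univ' (I.restrict fun t => Y t ω)]
  rw [map_sum]
  refine Finset.sum_congr rfl fun i _ => ?_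
  rw [h1 i, map_smul, smul_eq_mul, mul_comm]
  rfl

end GaussianSpace

/-! ### The Wiener isometry. -/

section WienerIntegral

lemma stronglyMeasurable_spaceFourier {g : ℝ × ℝ → ℝ} (hg : Measurable g) :
    StronglyMeasurable (spaceFourier g) := by
  unfold spaceFourier
  have h : StronglyMeasurable (fun q : (ℝ × ℝ) × ℝ =>
      Complex.exp (-(Complex.I * (q.1.2 : ℂ) * (q.2 : ℂ))) * (g (q.1.1, q.2) : ℂ)) := by
    refine Measurable.stronglyMeasurable ?_
    have : Measurable fun q : (ℝ × ℝ) × ℝ => g (q.1.1, q.2) := hg.comp (by fun_prop)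
    fun_prop
  exact h.integral_prod_right'

variable {Ω : Type*} [MeasurableSpace Ω] {P : Measure Ω} {H : ℝ}
  {W : 𝓓(halfPlane, ℝ) → Ω → ℝ} {g g' : ℝ × ℝ → ℝ} {Y Y' : Ω → ℝ}

lemma IsFractionalNoise.memLp (hW : IsFractionalNoise H W P) (φ : 𝓓(halfPlane, ℝ)) :
    MemLp (W φ) 2 P :=
  (hW.gaussian.hasGaussianLaw_eval φ).memLp_two

/-- The real inner product of complex functions is the real part of the covariance integral. The
`MemLp` assumptions make that integrand integrable, so that the real part may be taken inside. -/
lemma IsFractionalNoise.inner_eq (hW : IsFractionalNoise H W P) {φ ψ : 𝓓(halfPlane, ℝ)}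
    (hφ : MemLp (spaceFourier φ) 2 (noiseMeasure H))
    (hψ : MemLp (spaceFourier ψ) 2 (noiseMeasure H)) :
    inner ℝ ((hW.memLp φ).toLp (W φ)) ((hW.memLp ψ).toLp (W ψ))
      = inner ℝ (hφ.toLp (spaceFourier φ)) (hψ.toLp (spaceFourier ψ)) := by
  rw [L2.inner_def, L2.inner_def]
  have h1 : ∫ ω, inner ℝ ((hW.memLp φ).toLp (W φ) ω) ((hW.memLp ψ).toLp (W ψ) ω) ∂P
      = ∫ ω, W φ ω * W ψ ω ∂P := by
    refine integral_congr_ae ?_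
    filter_upwards [(hW.memLp φ).coeFn_toLp, (hW.memLp ψ).coeFn_toLp] with ω h1 h2
    rw [h1, h2]
    simp [mul_comm]
  have h2 : ∫ p, inner ℝ (hφ.toLp (spaceFourier φ) p) (hψ.toLp (spaceFourier ψ) p)
        ∂(noiseMeasure H)
      = ∫ p, (spaceFourier φ p * (starRingEnd ℂ) (spaceFourier ψ p)).re ∂(noiseMeasure H) := by
    refine integral_congr_ae ?_
    filter_upwards [hφ.coeFn_toLp, hψ.coeFn_toLp] with p h1 h2
    rw [h1, h2, Complex.inner]
    simp
    ring
  have hint : Integrable (fun p => spaceFourier φ p * (starRingEnd ℂ) (spaceFourier ψ p))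
      (noiseMeasure H) := hφ.integrable_mul hψ.star
  have h3 := congrArg Complex.re (hW.covariance φ ψ)
  rw [Complex.ofReal_re] at h3
  rw [h1, h2, h3]
  exact (Complex.reCLM.integral_comp_comm hint).symm

lemma IsWienerIntegral.exists_seq (hW : IsFractionalNoise H W P)
    (h : IsWienerIntegral H W P g Y) :
    ∃ (φ : ℕ → 𝓓(halfPlane, ℝ)) (hφ : ∀ n, MemLp (spaceFourier (φ n)) 2 (noiseMeasure H)),
      Tendsto (fun n => (hφ n).toLp (spaceFourier (φ n))) atTop
        (𝓝 (h.2.1.toLp (spaceFourier g))) ∧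
      Tendsto (fun n => (hW.memLp (φ n)).toLp (W (φ n))) atTop (𝓝 (h.2.2.1.toLp Y)) := by
  obtain ⟨-, hF, hY, φ, h1, h2⟩ := id h
  obtain ⟨N, hN⟩ := eventually_atTop.1 (h1.eventually_lt_const ENNReal.zero_lt_top)
  -- Convergence of the norms gives finiteness only from some index on, hence the shift by `N`.
  have hmem : ∀ n, MemLp (spaceFourier (φ (n + N))) 2 (noiseMeasure H) := by
    intro n
    have hm : MemLp (fun p => spaceFourier (φ (n + N)) p - spaceFourier g p) 2 (noiseMeasure H) :=
      ⟨((stronglyMeasurable_spaceFourier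
        (φ (n + N)).continuous.measurable).aestronglyMeasurable).sub hF.1, hN _ (by omega)⟩
    convert hm.add hF using 1
    ext p
    simp
  refine ⟨fun n => φ (n + N), hmem, ?_, ?_⟩
  · rw [Lp.tendsto_Lp_iff_tendsto_eLpNorm'' _ hmem]
    exact h1.comp (tendsto_add_atTop_nat N)
  · rw [Lp.tendsto_Lp_iff_tendsto_eLpNorm'' _ (fun n => hW.memLp (φ (n + N)))]
    exact h2.comp (tendsto_add_atTop_nat N)

lemma IsWienerIntegral.inner_eq (hW : IsFractionalNoise H W P)
    (h : IsWienerIntegral H W P g Y) (h' : IsWienerIntegral H W P g' Y') :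
    inner ℝ (h.2.2.1.toLp Y) (h'.2.2.1.toLp Y')
      = inner ℝ (h.2.1.toLp (spaceFourier g)) (h'.2.1.toLp (spaceFourier g')) := by
  obtain ⟨φ, hφ, h1, h2⟩ := h.exists_seq hW
  obtain ⟨ψ, hψ, h3, h4⟩ := h'.exists_seq hW
  refine tendsto_nhds_unique (h2.inner h4) ?_
  simp only [fun n => hW.inner_eq (hφ n) (hψ n)]
  exact h1.inner h3

lemma IsWienerIntegral.mem_gaussianSpace (hW : IsFractionalNoise H W P)
    (h : IsWienerIntegral H W P g Y) : h.2.2.1.toLp Y ∈ gaussianSpace W P := by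
  obtain ⟨φ, hφ, -, h2⟩ := h.exists_seq hW
  refine (isClosed_gaussianSpace W).mem_of_tendsto h2 (Eventually.of_forall fun n => ?_)
  exact Submodule.le_topologicalClosure _ (Submodule.subset_span ⟨φ n, MemLp.coeFn_toLp _⟩)

end WienerIntegral

/-! ### Covariance of the stochastic convolution in time and in space. -/

section HeatTransform

variable {H κ : ℝ}

lemma c1_pos (hH : H ∈ Ioo (0 : ℝ) 1) : 0 < c1 H := by
  unfold c1
  have h1 := Real.Gamma_pos_of_pos (show 0 < 2 * H + 1 by linarith [hH.1])
  have h2 : 0 < Real.sin (H * Real.pi) :=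
    Real.sin_pos_of_pos_of_lt_pi (by have := hH.1; positivity)
      (by nlinarith [hH.2, Real.pi_pos])
  positivity

lemma integral_fourier_heatKernel (hκ : 0 < κ) {τ : ℝ} (hτ : 0 < τ) (x ξ : ℝ) :
    ∫ y : ℝ, Complex.exp (-(Complex.I * (ξ : ℂ) * (y : ℂ))) * (heatKernel κ τ (x - y) : ℂ)
      = Complex.exp (-(Complex.I * (x * ξ : ℝ))) * (Real.exp (-(κ * τ * ξ ^ 2 / 2)) : ℂ) := by
  have hb : 0 < 1 / (2 * κ * τ) := by positivity
  have h1 := fourierIntegral_gaussian (b := ((1 / (2 * κ * τ) : ℝ) : ℂ)) (by simpa using hb) ξ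
  have h2 : ∀ y : ℝ,
      Complex.exp (-(Complex.I * (ξ : ℂ) * (y : ℂ))) * (heatKernel κ τ (x - y) : ℂ)
      = (fun z : ℝ => Complex.exp (-(Complex.I * (x * ξ : ℝ))) *
          ((1 / Real.sqrt (2 * Real.pi * κ * τ) : ℝ) : ℂ) *
          (Complex.exp (Complex.I * ξ * z) *
            Complex.exp (-((1 / (2 * κ * τ) : ℝ) : ℂ) * z ^ 2))) (x - y) := by
    intro y
    have e1 : Complex.exp (-(Complex.I * (ξ : ℂ) * (y : ℂ)))
        = Complex.exp (-(Complex.I * (x * ξ : ℝ))) *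
          Complex.exp (Complex.I * ξ * ((x - y : ℝ) : ℂ)) := by
      rw [← Complex.exp_add]; congr 1; push_cast; ring
    have e2 : (heatKernel κ τ (x - y) : ℂ) = ((1 / Real.sqrt (2 * Real.pi * κ * τ) : ℝ) : ℂ) *
        Complex.exp (-((1 / (2 * κ * τ) : ℝ) : ℂ) * ((x - y : ℝ) : ℂ) ^ 2) := by
      unfold heatKernel
      push_cast
      congr 2
      field_simp
    simp only []
    rw [e1, e2]
    ring
  simp_rw [h2]
  rw [integral_sub_left_eq_self (μ := volume) (fun z : ℝ => Complex.exp (-(Complex.I * (x * ξ : ℝ))) *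
          ((1 / Real.sqrt (2 * Real.pi * κ * τ) : ℝ) : ℂ) *
          (Complex.exp (Complex.I * ξ * z) *
            Complex.exp (-((1 / (2 * κ * τ) : ℝ) : ℂ) * z ^ 2))) x,
    integral_const_mul, h1]
  have e3 : ((Real.pi : ℂ) / ((1 / (2 * κ * τ) : ℝ) : ℂ)) ^ (1 / 2 : ℂ)
      = (Real.sqrt (2 * Real.pi * κ * τ) : ℂ) := by
    rw [Real.sqrt_eq_rpow, Complex.ofReal_cpow (by positivity)]
    congr 1
    · push_cast; field_simp
    · norm_num
  have e4 : Complex.exp (-(ξ : ℂ) ^ 2 / (4 * ((1 / (2 * κ * τ) : ℝ) : ℂ)))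
      = (Real.exp (-(κ * τ * ξ ^ 2 / 2)) : ℂ) := by
    rw [Complex.ofReal_exp]
    congr 1
    push_cast
    field_simp
    ring
  have hs : (Real.sqrt (2 * Real.pi * κ * τ) : ℂ) ≠ 0 := by
    have : 0 < Real.sqrt (2 * Real.pi * κ * τ) := by positivity
    exact_mod_cast this.ne'
  rw [e3, e4]
  push_cast
  field_simp

lemma spaceFourier_convKernel (hκ : 0 < κ) (t x : ℝ) (p : ℝ × ℝ) :
    spaceFourier (convKernel κ t x) p = if p.1 < t then
      Complex.exp (-(Complex.I * (x * p.2 : ℝ))) *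
        (Real.exp (-(κ * (t - p.1) * p.2 ^ 2 / 2)) : ℂ) else 0 := by
  unfold spaceFourier convKernel
  split_ifs with h
  · exact integral_fourier_heatKernel hκ (sub_pos.2 h) x p.2
  · simp

/-- The phases e^(-ixξ) and e^(-iyξ) combine to e^(i(x-y)ξ), whose real part is the cosine. -/
lemma inner_spaceFourier_convKernel (hκ : 0 < κ) (t r x y : ℝ) (p : ℝ × ℝ) :
    inner ℝ (spaceFourier (convKernel κ t x) p) (spaceFourier (convKernel κ r y) p)
      = if p.1 < min t r then
        Real.cos ((x - y) * p.2) * Real.exp (-(κ * (t + r - 2 * p.1) / 2 * p.2 ^ 2)) else 0 := by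
  rw [spaceFourier_convKernel hκ, spaceFourier_convKernel hκ, Complex.inner]
  by_cases h1 : p.1 < t <;> by_cases h2 : p.1 < r <;> simp only [h1, h2, lt_min_iff, and_true,
    and_false, if_true, if_false, map_zero, mul_zero, zero_mul, Complex.zero_re]
  have e : (starRingEnd ℂ) (Complex.exp (-(Complex.I * (x * p.2 : ℝ))) *
        (Real.exp (-(κ * (t - p.1) * p.2 ^ 2 / 2)) : ℂ)) *
      (Complex.exp (-(Complex.I * (y * p.2 : ℝ))) *
        (Real.exp (-(κ * (r - p.1) * p.2 ^ 2 / 2)) : ℂ))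
      = Complex.exp (((x - y) * p.2 : ℝ) * Complex.I) *
        (Real.exp (-(κ * (t + r - 2 * p.1) / 2 * p.2 ^ 2)) : ℂ) := by
    rw [map_mul, Complex.conj_ofReal, ← Complex.exp_conj]
    rw [show -(κ * (t + r - 2 * p.1) / 2 * p.2 ^ 2)
      = -(κ * (t - p.1) * p.2 ^ 2 / 2) + -(κ * (r - p.1) * p.2 ^ 2 / 2) by ring, Real.exp_add,
      show (((x - y) * p.2 : ℝ) : ℂ) * Complex.I
        = (starRingEnd ℂ) (-(Complex.I * (x * p.2 : ℝ))) + -(Complex.I * (y * p.2 : ℝ)) by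
          simp; ring, Complex.exp_add]
    push_cast
    ring
  rw [mul_comm, e, Complex.re_mul_ofReal, Complex.exp_ofReal_mul_I_re]

lemma integral_abs_rpow_mul_exp {q b : ℝ} (hq : -1 < q) (hb : 0 < b) :
    ∫ ξ : ℝ, |ξ| ^ q * Real.exp (-(b * ξ ^ 2))
      = b ^ (-(q + 1) / 2) * Real.Gamma ((q + 1) / 2) := by
  have h := integral_comp_abs (f := fun u : ℝ => u ^ q * Real.exp (-b * u ^ (2 : ℝ)))
  rw [integral_rpow_mul_exp_neg_mul_rpow two_pos hq hb] at h
  have e : ∀ ξ : ℝ, |ξ| ^ q * Real.exp (-(b * ξ ^ 2))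
      = |ξ| ^ q * Real.exp (-b * |ξ| ^ (2 : ℝ)) := by
    intro ξ
    rw [Real.rpow_two, sq_abs, neg_mul]
  simp_rw [e]
  rw [h]
  ring

lemma integrable_abs_rpow_mul_exp {q b : ℝ} (hq : -1 < q) (hb : 0 < b) :
    Integrable fun ξ : ℝ => |ξ| ^ q * Real.exp (-(b * ξ ^ 2)) := by
  -- A non-integrable function has Bochner integral 0, so the nonzero explicit value already proves
  -- integrability.
  refine Integrable.of_integral_ne_zero ?_
  rw [integral_abs_rpow_mul_exp hq hb]
  have := Real.Gamma_pos_of_pos (show 0 < (q + 1) / 2 by linarith)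
  positivity

lemma integral_withDensity_noise (hH : H ∈ Ioo (0 : ℝ) 1) (f : ℝ → ℝ) :
    ∫ ξ, f ξ ∂((volume : Measure ℝ).withDensity
        (fun ξ => ENNReal.ofReal (c1 H * |ξ| ^ (1 - 2 * H))))
      = ∫ ξ, c1 H * |ξ| ^ (1 - 2 * H) * f ξ := by
  rw [integral_withDensity_eq_integral_toReal_smul₀ (by fun_prop) (by simp)]
  refine integral_congr_ae (Eventually.of_forall fun ξ => ?_)
  have := (c1_pos hH).le
  simp only [smul_eq_mul]
  rw [ENNReal.toReal_ofReal (by positivity)]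

lemma integral_rpow_sub_two_mul (hH : H ∈ Ioo (0 : ℝ) 1) {t r : ℝ} :
    ∫ s in (0 : ℝ)..(min t r), (t + r - 2 * s) ^ (H - 1)
      = ((t + r) ^ H - |t - r| ^ H) / (2 * H) := by
  have hH0 := hH.1.ne'
  rw [intervalIntegral.integral_comp_sub_mul (fun v => v ^ (H - 1)) two_ne_zero,
    integral_rpow (Or.inl (by linarith [hH.1]))]
  have : t + r - 2 * min t r = |t - r| := by
    rcases le_total t r with h | h
    · rw [min_eq_left h, abs_of_nonpos (by linarith)]; ring
    · rw [min_eq_right h, abs_of_nonneg (by linarith)]; ring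
  rw [this]
  simp
  field_simp

instance : SFinite (noiseMeasure H) := by unfold noiseMeasure; infer_instance

/-- The temporal covariance constant of the stochastic convolution. -/
noncomputable def covConst (H κ : ℝ) : ℝ :=
  c1 H * Real.Gamma (1 - H) * (κ / 2) ^ (H - 1) / (2 * H)

/-- Integrating in ξ first gives a multiple of (t + r - 2s)^(H-1), which is then integrated over s
up to min(t, r). -/
lemma inner_convKernel_time (hH : H ∈ Ioo (0 : ℝ) 1) (hκ : 0 < κ) {t r : ℝ} (ht : 0 ≤ t)
    (hr : 0 ≤ r) (x : ℝ)
    (h1 : MemLp (spaceFourier (convKernel κ t x)) 2 (noiseMeasure H))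
    (h2 : MemLp (spaceFourier (convKernel κ r x)) 2 (noiseMeasure H)) :
    inner ℝ (h1.toLp _) (h2.toLp _) = covConst H κ * ((t + r) ^ H - |t - r| ^ H) := by
  have hint := L2.integrable_inner (𝕜 := ℝ) (h1.toLp _) (h2.toLp _)
  rw [L2.inner_def]
  have hae : (fun p => inner ℝ (h1.toLp _ p) (h2.toLp _ p)) =ᵐ[noiseMeasure H]
      fun p => if p.1 < min t r then
        Real.exp (-(κ * (t + r - 2 * p.1) / 2 * p.2 ^ 2)) else 0 := by
    filter_upwards [h1.coeFn_toLp, h2.coeFn_toLp] with p e1 e2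
    rw [e1, e2, inner_spaceFourier_convKernel hκ]
    simp
  rw [integral_congr_ae hae]
  have hint' := hint.congr hae
  unfold noiseMeasure at hint' ⊢
  rw [integral_prod _ hint']
  simp_rw [integral_withDensity_noise hH]
  have hmin : 0 ≤ min t r := le_min ht hr
  have hinner : ∀ s : ℝ, ∫ ξ : ℝ, c1 H * |ξ| ^ (1 - 2 * H) * (if s < min t r then
        Real.exp (-(κ * (t + r - 2 * s) / 2 * ξ ^ 2)) else 0)
      = (Iio (min t r)).indicator (fun s => c1 H * Real.Gamma (1 - H) * (κ / 2) ^ (H - 1) *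
          (t + r - 2 * s) ^ (H - 1)) s := by
    intro s
    by_cases hs : s < min t r
    · have hpos : 0 < t + r - 2 * s := by
        have := lt_min_iff.1 hs; linarith
      have hb : 0 < κ * (t + r - 2 * s) / 2 := by positivity
      simp only [hs, if_true, mul_assoc]
      rw [indicator_of_mem (show s ∈ Iio (min t r) from hs), integral_const_mul,
        integral_abs_rpow_mul_exp (by linarith [hH.2]) hb,
        show κ * (t + r - 2 * s) / 2 = κ / 2 * (t + r - 2 * s) by ring,
        Real.mul_rpow (by positivity) hpos.le,
        show -(1 - 2 * H + 1) / 2 = H - 1 by ring, show (1 - 2 * H + 1) / 2 = 1 - H by ring]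
      ring
    · simp [hs]
  simp_rw [hinner]
  rw [integral_indicator measurableSet_Iio, Measure.restrict_restrict measurableSet_Iio,
    show Iio (min t r) ∩ Ioi 0 = Ioo 0 (min t r) by ext; simp [and_comm],
    ← integral_Ioc_eq_integral_Ioo, ← intervalIntegral.integral_of_le hmin,
    intervalIntegral.integral_const_mul, integral_rpow_sub_two_mul hH]
  unfold covConst
  ring

lemma integral_exp_time (hκ : 0 < κ) {t : ℝ} {ξ : ℝ} (hξ : ξ ≠ 0) :
    ∫ s in (0 : ℝ)..t, Real.exp (-(κ * (t + t - 2 * s) / 2 * ξ ^ 2))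
      = (1 - Real.exp (-(κ * t * ξ ^ 2))) / (κ * ξ ^ 2) := by
  have hc : κ * ξ ^ 2 ≠ 0 := by positivity
  have e : ∀ s : ℝ, Real.exp (-(κ * (t + t - 2 * s) / 2 * ξ ^ 2))
      = (fun v => Real.exp v) (κ * ξ ^ 2 * s - κ * t * ξ ^ 2) := by
    intro s; simp only []; congr 1; ring
  simp_rw [e]
  rw [intervalIntegral.integral_comp_mul_sub (fun v => Real.exp v) hc, integral_exp]
  simp only [mul_zero, zero_sub, smul_eq_mul]
  rw [show κ * ξ ^ 2 * t - κ * t * ξ ^ 2 = 0 by ring, Real.exp_zero]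
  field_simp

/-- The spatial spectral density of the stochastic convolution at time `t`. -/
noncomputable def spectralDensity (H κ t ξ : ℝ) : ℝ :=
  c1 H * |ξ| ^ (1 - 2 * H) * ((1 - Real.exp (-(κ * t * ξ ^ 2))) / (κ * ξ ^ 2))

/-- Here s is integrated first, which leaves a spectral integral in ξ. Integrability comes for free
from Fubini, the kernels being in L². -/
lemma inner_convKernel_space (hH : H ∈ Ioo (0 : ℝ) 1) (hκ : 0 < κ) {t : ℝ} (ht : 0 ≤ t) (x y : ℝ)
    (h1 : MemLp (spaceFourier (convKernel κ t x)) 2 (noiseMeasure H))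
    (h2 : MemLp (spaceFourier (convKernel κ t y)) 2 (noiseMeasure H)) :
    Integrable (fun ξ => spectralDensity H κ t ξ * Real.cos ((x - y) * ξ)) ∧
    inner ℝ (h1.toLp _) (h2.toLp _) = ∫ ξ, spectralDensity H κ t ξ * Real.cos ((x - y) * ξ) := by
  have hint := L2.integrable_inner (𝕜 := ℝ) (h1.toLp _) (h2.toLp _)
  rw [L2.inner_def]
  have hae : (fun p => inner ℝ (h1.toLp _ p) (h2.toLp _ p)) =ᵐ[noiseMeasure H]
      fun p => if p.1 < t then
        Real.cos ((x - y) * p.2) * Real.exp (-(κ * (t + t - 2 * p.1) / 2 * p.2 ^ 2)) else 0 := by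
    filter_upwards [h1.coeFn_toLp, h2.coeFn_toLp] with p e1 e2
    rw [e1, e2, inner_spaceFourier_convKernel hκ]
    simp
  rw [integral_congr_ae hae]
  have hint' := hint.congr hae
  have hc := (c1_pos hH).le
  have hinner : ∀ ξ : ℝ, ξ ≠ 0 → c1 H * |ξ| ^ (1 - 2 * H) * ∫ s in Ioi (0 : ℝ), (if s < t then
        Real.cos ((x - y) * ξ) * Real.exp (-(κ * (t + t - 2 * s) / 2 * ξ ^ 2)) else 0)
      = spectralDensity H κ t ξ * Real.cos ((x - y) * ξ) := by
    intro ξ hξ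
    have e : ∀ s : ℝ, (if s < t then
        Real.cos ((x - y) * ξ) * Real.exp (-(κ * (t + t - 2 * s) / 2 * ξ ^ 2)) else 0)
        = (Iio t).indicator (fun s =>
          Real.cos ((x - y) * ξ) * Real.exp (-(κ * (t + t - 2 * s) / 2 * ξ ^ 2))) s := by
      intro s; simp [indicator]
    simp_rw [e]
    rw [integral_indicator measurableSet_Iio, Measure.restrict_restrict measurableSet_Iio,
      show Iio t ∩ Ioi 0 = Ioo 0 t by ext; simp [and_comm],
      ← integral_Ioc_eq_integral_Ioo, ← intervalIntegral.integral_of_le ht,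
      intervalIntegral.integral_const_mul, integral_exp_time hκ hξ, spectralDensity]
    ring
  have hne : ∀ᵐ ξ : ℝ, ξ ≠ 0 := by simp [ae_iff]
  unfold noiseMeasure at hint' ⊢
  constructor
  · have h3 := hint'.integral_prod_right
    rw [integrable_withDensity_iff_integrable_smul₀' (by fun_prop) (by simp)] at h3
    refine h3.congr ?_
    filter_upwards [hne] with ξ hξ
    rw [← hinner ξ hξ, smul_eq_mul, ENNReal.toReal_ofReal (by positivity)]
  · rw [integral_prod_symm _ hint', integral_withDensity_noise hH]
    refine integral_congr_ae ?_
    filter_upwards [hne] with ξ hξ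
    exact hinner ξ hξ

end HeatTransform

/-! ### The constant in the spectral representation of fBm. -/

section CosineIntegral

lemma lintegral_ofReal_eq_of_integral_pos {α : Type*} [MeasurableSpace α] {μ : Measure α}
    {f : α → ℝ} (h0 : 0 ≤ᵐ[μ] f) (hpos : 0 < ∫ a, f a ∂μ) :
    ∫⁻ a, ENNReal.ofReal (f a) ∂μ = ENNReal.ofReal (∫ a, f a ∂μ) :=
  (ofReal_integral_eq_lintegral_ofReal (Integrable.of_integral_ne_zero hpos.ne') h0).symm

lemma integral_one_sub_cos_mul_exp {l : ℝ} (hl : 0 < l) :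
    ∫ ξ in Ioi (0 : ℝ), (1 - Real.cos ξ) * Real.exp (-(l * ξ)) = 1 / (l * (1 + l ^ 2)) := by
  have ha : (-(l : ℂ) + Complex.I).re < 0 := by simpa using hl
  have h1 := integral_exp_mul_complex_Ioi ha 0
  have i1 := integrableOn_exp_mul_complex_Ioi ha 0
  have i2 := integrableOn_exp_mul_Ioi (neg_lt_zero.2 hl) 0
  have h2 := integral_exp_mul_Ioi (neg_lt_zero.2 hl) 0
  have e : ∀ ξ : ℝ, (1 - Real.cos ξ) * Real.exp (-(l * ξ))
      = Real.exp (-l * ξ) - (Complex.exp ((-(l : ℂ) + Complex.I) * ξ)).re := by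
    intro ξ
    rw [Complex.exp_re]
    simp
    ring
  simp_rw [e]
  have i3 : IntegrableOn (fun ξ : ℝ => (Complex.exp ((-(l : ℂ) + Complex.I) * ξ)).re) (Ioi 0) :=
    i1.re
  have h3 := Complex.reCLM.integral_comp_comm i1
  simp only [Complex.reCLM_apply] at h3
  rw [integral_sub i2 i3, h2, h3, h1]
  have h4 : (-Complex.exp ((-(l : ℂ) + Complex.I) * (0 : ℝ)) / (-(l : ℂ) + Complex.I)).re
      = l / (l ^ 2 + 1) := by
    rw [Complex.div_re]
    simp [Complex.normSq_apply, sq]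
  rw [h4]
  simp only [mul_zero, Real.exp_zero, neg_div_neg_eq]
  field_simp
  ring

/-- Write 1/(1 + l²) as ∫ e^(-r(1+l²)) dr and apply Tonelli; both resulting integrals are Gamma
integrals. -/
lemma lintegral_rpow_div_one_add_sq {H : ℝ} (hH : H ∈ Ioo (0 : ℝ) 1) :
    ∫⁻ l in Ioi (0 : ℝ), ENNReal.ofReal (l ^ (2 * H - 1) * (1 / (1 + l ^ 2)))
      = ENNReal.ofReal (Real.Gamma H * Real.Gamma (1 - H) / 2) := by
  have hG := Real.Gamma_pos_of_pos hH.1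
  have hG' := Real.Gamma_pos_of_pos (show 0 < 1 - H by linarith [hH.2])
  have e1 : ∀ l ∈ Ioi (0 : ℝ), ENNReal.ofReal (l ^ (2 * H - 1) * (1 / (1 + l ^ 2)))
      = ∫⁻ r in Ioi (0 : ℝ), ENNReal.ofReal
          (l ^ (2 * H - 1) * Real.exp (-(r * l ^ 2)) * Real.exp (-r)) := by
    intro l hl
    have hl' : (0 : ℝ) < l := hl
    have h1 : ∫ r in Ioi (0 : ℝ), l ^ (2 * H - 1) * Real.exp (-(r * l ^ 2)) * Real.exp (-r)
        = l ^ (2 * H - 1) * (1 / (1 + l ^ 2)) := by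
      have h2 := integral_exp_mul_Ioi (a := -(1 + l ^ 2)) (by nlinarith) 0
      have e : ∀ r : ℝ, l ^ (2 * H - 1) * Real.exp (-(r * l ^ 2)) * Real.exp (-r)
          = l ^ (2 * H - 1) * Real.exp (-(1 + l ^ 2) * r) := by
        intro r
        rw [mul_assoc, ← Real.exp_add]; ring_nf
      simp_rw [e]
      rw [integral_const_mul, h2]
      rw [mul_zero, Real.exp_zero, neg_div_neg_eq]
    rw [lintegral_ofReal_eq_of_integral_pos (Eventually.of_forall fun r => by positivity), h1]
    rw [h1]; positivity
  rw [setLIntegral_congr_fun measurableSet_Ioi e1, lintegral_lintegral_swap (by fun_prop)]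
  have e2 : ∀ r ∈ Ioi (0 : ℝ), ∫⁻ l in Ioi (0 : ℝ), ENNReal.ofReal
          (l ^ (2 * H - 1) * Real.exp (-(r * l ^ 2)) * Real.exp (-r))
      = ENNReal.ofReal (Real.Gamma H / 2 * (r ^ (1 - H - 1) * Real.exp (-(1 * r)))) := by
    intro r hr
    have hr' : (0 : ℝ) < r := hr
    have h2 := integral_rpow_mul_exp_neg_mul_rpow (p := 2) (q := 2 * H - 1) two_pos
      (by linarith [hH.1]) hr'
    have h1 : ∫ l in Ioi (0 : ℝ), l ^ (2 * H - 1) * Real.exp (-(r * l ^ 2)) * Real.exp (-r)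
        = Real.Gamma H / 2 * (r ^ (1 - H - 1) * Real.exp (-(1 * r))) := by
      simp_rw [Real.rpow_two, neg_mul] at h2
      rw [integral_mul_const, h2]
      rw [show -(2 * H - 1 + 1) / 2 = 1 - H - 1 by ring, show (2 * H - 1 + 1) / 2 = H by ring]
      simp
      ring
    rw [lintegral_ofReal_eq_of_integral_pos _ (by rw [h1]; positivity), h1]
    filter_upwards [ae_restrict_mem measurableSet_Ioi] with l hl
    have hl' : (0 : ℝ) < l := hl
    simp only [Pi.zero_apply]
    positivity
  rw [setLIntegral_congr_fun measurableSet_Ioi e2]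
  have h3 : ∫ r in Ioi (0 : ℝ), Real.Gamma H / 2 * (r ^ (1 - H - 1) * Real.exp (-(1 * r)))
      = Real.Gamma H * Real.Gamma (1 - H) / 2 := by
    rw [integral_const_mul, Real.integral_rpow_mul_exp_neg_mul_Ioi (by linarith [hH.2]) one_pos]
    simp
    ring
  rw [lintegral_ofReal_eq_of_integral_pos _ (by rw [h3]; positivity), h3]
  filter_upwards [ae_restrict_mem measurableSet_Ioi] with l hl
  have hl' : (0 : ℝ) < l := hl
  simp only [Pi.zero_apply]
  positivity

/-- Write Γ(2H+1) ξ^(-1-2H) as ∫ l^(2H) e^(-ξl) dl and apply Tonelli; the inner integral is then the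
Laplace transform of 1 - cos. -/
lemma lintegral_one_sub_cos_mul_rpow {H : ℝ} (hH : H ∈ Ioo (0 : ℝ) 1) :
    ∫⁻ ξ in Ioi (0 : ℝ), ENNReal.ofReal ((1 - Real.cos ξ) * ξ ^ (-1 - 2 * H))
      = ENNReal.ofReal (Real.Gamma H * Real.Gamma (1 - H) / 2 / Real.Gamma (2 * H + 1)) := by
  have hG := Real.Gamma_pos_of_pos hH.1
  have hG' := Real.Gamma_pos_of_pos (show 0 < 1 - H by linarith [hH.2])
  have hG2 := Real.Gamma_pos_of_pos (show 0 < 2 * H + 1 by linarith [hH.1])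
  have e1 : ∀ ξ ∈ Ioi (0 : ℝ), ENNReal.ofReal ((1 - Real.cos ξ) * ξ ^ (-1 - 2 * H))
      = ∫⁻ l in Ioi (0 : ℝ), ENNReal.ofReal ((1 - Real.cos ξ) / Real.Gamma (2 * H + 1)) *
          ENNReal.ofReal (l ^ (2 * H + 1 - 1) * Real.exp (-(ξ * l))) := by
    intro ξ hξ
    have hξ' : (0 : ℝ) < ξ := hξ
    have hc : 0 ≤ 1 - Real.cos ξ := by linarith [Real.cos_le_one ξ]
    have h1 := Real.integral_rpow_mul_exp_neg_mul_Ioi (show 0 < 2 * H + 1 by linarith [hH.1]) hξ'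
    rw [lintegral_const_mul _ (by fun_prop), lintegral_ofReal_eq_of_integral_pos _
      (by rw [h1]; positivity), h1, ← ENNReal.ofReal_mul (by positivity)]
    · congr 1
      rw [show -1 - 2 * H = -(2 * H + 1) by ring, Real.rpow_neg hξ'.le, one_div,
        Real.inv_rpow hξ'.le]
      field_simp
    · filter_upwards [ae_restrict_mem measurableSet_Ioi] with l hl
      have hl' : (0 : ℝ) < l := hl
      simp only [Pi.zero_apply]
      positivity
  rw [setLIntegral_congr_fun measurableSet_Ioi e1, lintegral_lintegral_swap (by fun_prop)]
  have e2 : ∀ l ∈ Ioi (0 : ℝ), ∫⁻ ξ in Ioi (0 : ℝ),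
        ENNReal.ofReal ((1 - Real.cos ξ) / Real.Gamma (2 * H + 1)) *
          ENNReal.ofReal (l ^ (2 * H + 1 - 1) * Real.exp (-(ξ * l)))
      = ENNReal.ofReal (1 / Real.Gamma (2 * H + 1)) *
          ENNReal.ofReal (l ^ (2 * H - 1) * (1 / (1 + l ^ 2))) := by
    intro l hl
    have hl' : (0 : ℝ) < l := hl
    have h1 := integral_one_sub_cos_mul_exp hl'
    have hc : ∀ ξ, 0 ≤ 1 - Real.cos ξ := fun ξ => by linarith [Real.cos_le_one ξ]
    have e3 : ∀ ξ : ℝ, ENNReal.ofReal ((1 - Real.cos ξ) / Real.Gamma (2 * H + 1)) *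
          ENNReal.ofReal (l ^ (2 * H + 1 - 1) * Real.exp (-(ξ * l)))
        = ENNReal.ofReal (l ^ (2 * H) / Real.Gamma (2 * H + 1)) *
          ENNReal.ofReal ((1 - Real.cos ξ) * Real.exp (-(l * ξ))) := by
      intro ξ
      have := hc ξ
      rw [← ENNReal.ofReal_mul (by positivity), ← ENNReal.ofReal_mul (by positivity)]
      congr 1
      rw [add_sub_cancel_right, mul_comm ξ l]
      ring
    simp_rw [e3]
    rw [lintegral_const_mul _ (by fun_prop), lintegral_ofReal_eq_of_integral_pos
      (Eventually.of_forall fun ξ => by have := hc ξ; simp only [Pi.zero_apply]; positivity)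
      (by rw [h1]; positivity), h1, ← ENNReal.ofReal_mul (by positivity),
      ← ENNReal.ofReal_mul (by positivity)]
    congr 1
    rw [show 2 * H = 2 * H - 1 + 1 by ring, Real.rpow_add_one hl'.ne']
    field_simp
    ring_nf
  rw [setLIntegral_congr_fun measurableSet_Ioi e2, lintegral_const_mul _ (by fun_prop),
    lintegral_rpow_div_one_add_sq hH, ← ENNReal.ofReal_mul (by positivity)]
  congr 1
  ring

/-- The spectral representation of the variance of fractional Brownian motion. -/
lemma integral_one_sub_cos_mul_abs_rpow {H : ℝ} (hH : H ∈ Ioo (0 : ℝ) 1) (x : ℝ) :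
    ∫ ξ : ℝ, c1 H * |ξ| ^ (-1 - 2 * H) * (2 * (1 - Real.cos (x * ξ))) = |x| ^ (2 * H) := by
  have hc : ∀ ξ, 0 ≤ 1 - Real.cos ξ := fun ξ => by linarith [Real.cos_le_one ξ]
  have hG := Real.Gamma_pos_of_pos hH.1
  have hG' := Real.Gamma_pos_of_pos (show 0 < 1 - H by linarith [hH.2])
  have hG2 := Real.Gamma_pos_of_pos (show 0 < 2 * H + 1 by linarith [hH.1])
  have h1 : ∫ ξ in Ioi (0 : ℝ), (1 - Real.cos ξ) * ξ ^ (-1 - 2 * H)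
      = Real.Gamma H * Real.Gamma (1 - H) / 2 / Real.Gamma (2 * H + 1) := by
    rw [integral_eq_lintegral_of_nonneg_ae, lintegral_one_sub_cos_mul_rpow hH,
      ENNReal.toReal_ofReal (by positivity)]
    · filter_upwards [ae_restrict_mem measurableSet_Ioi] with l hl
      have hl' : (0 : ℝ) < l := hl
      have := hc l
      simp only [Pi.zero_apply]
      positivity
    · exact (by fun_prop : Measurable _).aestronglyMeasurable
  have hs : ∀ ξ : ℝ, c1 H * |ξ| ^ (-1 - 2 * H) * (2 * (1 - Real.cos (x * ξ)))
      = 2 * c1 H * (fun u : ℝ => (1 - Real.cos (|x| * u)) * u ^ (-1 - 2 * H)) |ξ| := by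
    intro ξ
    simp only [← abs_mul, Real.cos_abs]
    ring
  simp_rw [hs]
  rw [integral_const_mul,
    integral_comp_abs (f := fun u : ℝ => (1 - Real.cos (|x| * u)) * u ^ (-1 - 2 * H))]
  rcases eq_or_ne x 0 with rfl | hx
  · simp [Real.zero_rpow (show 2 * H ≠ 0 by have := hH.1; positivity)]
  have hx' : 0 < |x| := abs_pos.2 hx
  have h2 := integral_comp_mul_left_Ioi (fun u : ℝ => (1 - Real.cos u) * u ^ (-1 - 2 * H)) 0 hx'
  rw [mul_zero, h1] at h2
  have h3 : ∫ u in Ioi (0 : ℝ), (1 - Real.cos (|x| * u)) * u ^ (-1 - 2 * H)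
      = |x| ^ (2 * H + 1) * ∫ u in Ioi (0 : ℝ), (1 - Real.cos (|x| * u)) *
          (|x| * u) ^ (-1 - 2 * H) := by
    rw [← integral_const_mul]
    refine setIntegral_congr_fun measurableSet_Ioi fun u hu => ?_
    have hu' : (0 : ℝ) < u := hu
    rw [Real.mul_rpow hx'.le hu'.le, show -1 - 2 * H = -(2 * H + 1) by ring,
      Real.rpow_neg hx'.le]
    have : |x| ^ (2 * H + 1) ≠ 0 := by positivity
    field_simp
  have hs : 0 < Real.sin (Real.pi * H) :=
    Real.sin_pos_of_pos_of_lt_pi (by have := hH.1; positivity) (by nlinarith [hH.2, Real.pi_pos])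
  -- Euler's reflection formula makes Γ(H)Γ(1-H) cancel the sine in `c1`.
  rw [h3, h2, c1, Real.Gamma_mul_Gamma_one_sub, Real.rpow_add_one hx'.ne', smul_eq_mul,
    mul_comm H Real.pi]
  have := Real.pi_pos
  field_simp

end CosineIntegral

/-! ### Orthonormal sequences and isometric embeddings. -/

section Orthonormal

variable {ι E F : Type*} [NormedAddCommGroup E] [InnerProductSpace ℝ E]
  [NormedAddCommGroup F] [InnerProductSpace ℝ F]

lemma norm_linearCombination_eq {U : ι → E} {J : ι → F}
    (hUJ : ∀ i j, inner ℝ (U i) (U j) = inner ℝ (J i) (J j)) (l : ι →₀ ℝ) :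
    ‖Finsupp.linearCombination ℝ U l‖ = ‖Finsupp.linearCombination ℝ J l‖ := by
  rw [← sq_eq_sq₀ (norm_nonneg _) (norm_nonneg _), ← real_inner_self_eq_norm_sq,
    ← real_inner_self_eq_norm_sq]
  simp only [Finsupp.linearCombination_apply, Finsupp.sum, sum_inner, inner_sum,
    real_inner_smul_left, real_inner_smul_right, hUJ]

/-- `U` plays the random variables and `J` their integrands. The `ψ n` need not lie in the closed
span of `J`, so no random variable is attached to them; they only act as test vectors. They show
that the parts of the `U (v n)` orthogonal to the span of `U` on `S` are linearly independent, and
Gram–Schmidt does the rest. -/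
lemma exists_orthonormal_seq [CompleteSpace E] {U : ι → E} {J : ι → F}
    (hUJ : ∀ i j, inner ℝ (U i) (U j) = inner ℝ (J i) (J j)) (K : Submodule ℝ E)
    (hK : IsClosed (K : Set E)) (hU : ∀ i, U i ∈ K) (S : Set ι) (v : ℕ → ι) (ψ : ℕ → F)
    (hS : ∀ n, ∀ i ∈ S, inner ℝ (ψ n) (J i) = 0)
    (hlt : ∀ n, ∀ k < n, inner ℝ (ψ n) (J (v k)) = 0)
    (hne : ∀ n, inner ℝ (ψ n) (J (v n)) ≠ 0) :
    ∃ Z : ℕ → E, Orthonormal ℝ Z ∧ (∀ n, Z n ∈ K) ∧ ∀ n, ∀ i ∈ S, inner ℝ (Z n) (U i) = 0 := by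
  set M : Submodule ℝ E := (Submodule.span ℝ (U '' S)).topologicalClosure with hM
  have hMK : M ≤ K := Submodule.topologicalClosure_minimal _
    (Submodule.span_le.2 (by rintro _ ⟨i, -, rfl⟩; exact hU i)) hK
  have : CompleteSpace M :=
    (Submodule.isClosed_topologicalClosure (Submodule.span ℝ (U '' S))).completeSpace_coe
  set w : ℕ → E := fun n => U (v n) - M.starProjection (U (v n)) with hw
  have hwK : ∀ n, w n ∈ M.orthogonal ⊓ K := fun n =>
    ⟨Submodule.sub_starProjection_mem_orthogonal _,
      K.sub_mem (hU _) (hMK (Submodule.starProjection_apply_mem _ _))⟩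
  -- Equal Gram matrices carry an approximation by combinations over `S` from the `U` side to the
  -- `J` side, where `ψ n` annihilates the approximants.
  have hkill : ∀ n, ∀ l : ι →₀ ℝ, Finsupp.linearCombination ℝ U l ∈ M →
      inner ℝ (ψ n) (Finsupp.linearCombination ℝ J l) = 0 := by
    intro n l hl
    rw [← norm_le_zero_iff]
    refine le_of_forall_pos_le_add fun ε hε => ?_
    have hδ : 0 < ε / (‖ψ n‖ + 1) := by positivity
    obtain ⟨b, hb, hdist⟩ := Metric.mem_closure_iff.1 hl _ hδ
    obtain ⟨a, ha, rfl⟩ := (Finsupp.mem_span_image_iff_linearCombination ℝ).1 hb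
    have hz : inner ℝ (ψ n) (Finsupp.linearCombination ℝ J a) = 0 := by
      rw [Finsupp.linearCombination_apply, Finsupp.sum, inner_sum]
      refine Finset.sum_eq_zero fun i hi => ?_
      rw [real_inner_smul_right, hS n i ((Finsupp.mem_supported ℝ a).1 ha hi), mul_zero]
    rw [dist_eq_norm, ← map_sub, norm_linearCombination_eq hUJ, map_sub] at hdist
    calc ‖inner ℝ (ψ n) (Finsupp.linearCombination ℝ J l)‖
        = ‖inner ℝ (ψ n) (Finsupp.linearCombination ℝ J l
            - Finsupp.linearCombination ℝ J a)‖ := by rw [inner_sub_right, hz, sub_zero]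
      _ ≤ ‖ψ n‖ * (ε / (‖ψ n‖ + 1)) := (norm_inner_le_norm _ _).trans (by gcongr)
      _ ≤ 0 + ε := by
        rw [zero_add, mul_div_assoc', div_le_iff₀ (by positivity)]
        nlinarith [norm_nonneg (ψ n)]
  have hli : LinearIndependent ℝ w := by
    rw [linearIndependent_iff]
    intro c hc
    by_contra hc0
    have hne' : c.support.Nonempty := Finsupp.support_nonempty_iff.2 hc0
    -- Testing with `ψ n` for the largest index `n` in the support kills every term but the last, by
    -- triangularity.
    set n := c.support.max' hne' with hn
    have hcn : c n ≠ 0 := Finsupp.mem_support_iff.1 (c.support.max'_mem hne')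
    have hmem : Finsupp.linearCombination ℝ U (c.mapDomain v) ∈ M := by
      rw [Finsupp.linearCombination_mapDomain]
      have : Finsupp.linearCombination ℝ (U ∘ v) c
          = Finsupp.linearCombination ℝ (fun n => M.starProjection (U (v n))) c := by
        rw [← sub_eq_zero, ← hc]
        simp only [Finsupp.linearCombination_apply, Finsupp.sum, hw, Function.comp_apply, smul_sub,
          Finset.sum_sub_distrib]
      rw [this, Finsupp.linearCombination_apply, Finsupp.sum]
      exact M.sum_mem fun i _ => M.smul_mem _ (Submodule.starProjection_apply_mem _ _)
    have h0 := hkill n _ hmem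
    rw [Finsupp.linearCombination_mapDomain, Finsupp.linearCombination_apply, Finsupp.sum,
      inner_sum, Finset.sum_eq_single n] at h0
    · rw [real_inner_smul_right] at h0
      exact mul_ne_zero hcn (hne n) h0
    · intro k hk hkn
      rw [real_inner_smul_right, Function.comp_apply,
        hlt n k (lt_of_le_of_ne (c.support.le_max' k hk) hkn), mul_zero]
    · intro h
      exact absurd (c.support.max'_mem hne') h
  have hmem : ∀ n, InnerProductSpace.gramSchmidtNormed ℝ w n ∈ M.orthogonal ⊓ K := by
    intro n
    refine Submodule.smul_mem _ _ ?_
    refine Submodule.span_le.2 ?_ (InnerProductSpace.gramSchmidt_mem_span ℝ w le_rfl)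
    rintro _ ⟨k, -, rfl⟩
    exact hwK k
  refine ⟨InnerProductSpace.gramSchmidtNormed ℝ w,
    InnerProductSpace.gramSchmidtNormed_orthonormal hli, fun n => (hmem n).2, fun n i hi => ?_⟩
  rw [real_inner_comm]
  exact (hmem n).1 _ (Submodule.le_topologicalClosure _
    (Submodule.subset_span (mem_image_of_mem U hi)))

/-- Orthonormal vectors are at distance √2, so balls of radius 1/2 around them are disjoint. -/
lemma _root_.Orthonormal.countable_of_secondCountable [SecondCountableTopology E] {e : ι → E}
    (he : Orthonormal ℝ e) : Countable ι := by
  rw [← Set.countable_univ_iff]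
  refine Set.PairwiseDisjoint.countable_of_isOpen (s := fun i => Metric.ball (e i) (1 / 2)) ?_
    (fun _ _ => Metric.isOpen_ball) (fun i _ => ⟨e i, Metric.mem_ball_self (by norm_num)⟩)
  intro i _ j _ hij
  refine Metric.ball_disjoint_ball ?_
  rw [dist_eq_norm]
  have h : ‖e i - e j‖ ^ 2 = 2 := by
    rw [@norm_sub_sq_real, he.1 i, he.1 j, he.2 hij]; norm_num
  nlinarith [norm_nonneg (e i - e j)]

/-- A separable real Hilbert space embeds isometrically in the closed span of any
orthonormal sequence. -/
lemma exists_linearIsometry_of_orthonormal [CompleteSpace E] [CompleteSpace F]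
    [SecondCountableTopology F] {Z : ℕ → E} (hZ : Orthonormal ℝ Z) (K : Submodule ℝ E)
    (hK : IsClosed (K : Set E)) (hZK : ∀ n, Z n ∈ K) : ∃ T : F →ₗᵢ[ℝ] E, ∀ f, T f ∈ K := by
  obtain ⟨s, b, -⟩ := exists_hilbertBasis ℝ F
  have : Countable s := b.orthonormal.countable_of_secondCountable
  obtain ⟨φ, hφ⟩ := exists_injective_nat s
  have hV := (hZ.comp φ hφ).orthogonalFamily
  refine ⟨hV.linearIsometry.comp b.repr.toLinearIsometry, fun f => ?_⟩
  refine hK.mem_of_tendsto (hV.hasSum_linearIsometry (b.repr f)) (Eventually.of_forall fun t => ?_)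
  refine K.sum_mem fun i _ => ?_
  exact K.smul_mem _ (hZK _)

end Orthonormal

/-! ### Directions of the noise that are orthogonal to the observed part of the convolution. -/

section Innovations

lemma noiseMeasure_Ioo_prod_pos {H : ℝ} (hH : H ∈ Ioo (0 : ℝ) 1) {a b : ℝ} (ha : 0 ≤ a)
    (hab : a < b) : 0 < noiseMeasure H (Ioo a b ×ˢ Ioo 0 1) := by
  refine pos_iff_ne_zero.2 fun h0 => ?_
  have hac : (volume : Measure ℝ) ≪ (volume : Measure ℝ).withDensity
      (fun ξ => ENNReal.ofReal (c1 H * |ξ| ^ (1 - 2 * H))) := by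
    refine withDensity_absolutelyContinuous' (by fun_prop) ?_
    have hne : ∀ᵐ ξ : ℝ, ξ ≠ 0 := by simp [ae_iff]
    filter_upwards [hne] with ξ hξ
    have h1 := c1_pos hH
    have h2 : 0 < |ξ| := abs_pos.2 hξ
    exact (ENNReal.ofReal_pos.2 (by positivity)).ne'
  have h1 := ((Measure.AbsolutelyContinuous.refl
    (volume.restrict (Ioi (0 : ℝ)))).prod hac) h0
  rw [Measure.prod_prod, Measure.restrict_apply measurableSet_Ioo,
    inter_eq_left.2 (show Ioo a b ⊆ Ioi 0 from fun y hy => lt_of_le_of_lt ha hy.1)] at h1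
  simp at h1
  linarith

variable {Ω : Type*} [MeasurableSpace Ω] {P : Measure Ω} {H κ : ℝ}
  {W : 𝓓(halfPlane, ℝ) → Ω → ℝ} {u : ℝ≥0 → ℝ → Ω → ℝ}

/-- The stochastic convolution as an element of `L²(P)`. -/
noncomputable def IsStochasticConvolution.toL2 (hu : IsStochasticConvolution H κ W P u)
    (i : ℝ≥0 × ℝ) : Lp ℝ 2 P := (hu i.1 i.2).2.2.1.toLp (u i.1 i.2)

/-- The spatial Fourier transform of the kernel of the stochastic convolution, in `L²`. -/
noncomputable def IsStochasticConvolution.kernelL2 (hu : IsStochasticConvolution H κ W P u)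
    (i : ℝ≥0 × ℝ) : Lp ℂ 2 (noiseMeasure H) :=
  (hu i.1 i.2).2.1.toLp (spaceFourier (convKernel κ i.1 i.2))

lemma IsStochasticConvolution.coeFn_toL2 (hu : IsStochasticConvolution H κ W P u)
    (i : ℝ≥0 × ℝ) : hu.toL2 i =ᵐ[P] u i.1 i.2 := MemLp.coeFn_toLp _

lemma IsStochasticConvolution.coeFn_kernelL2 (hu : IsStochasticConvolution H κ W P u)
    (i : ℝ≥0 × ℝ) : hu.kernelL2 i =ᵐ[noiseMeasure H] spaceFourier (convKernel κ i.1 i.2) :=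
  MemLp.coeFn_toLp _

lemma IsStochasticConvolution.inner_toL2 (hu : IsStochasticConvolution H κ W P u)
    (hW : IsFractionalNoise H W P) (i j : ℝ≥0 × ℝ) :
    inner ℝ (hu.toL2 i) (hu.toL2 j) = inner ℝ (hu.kernelL2 i) (hu.kernelL2 j) :=
  (hu i.1 i.2).inner_eq hW (hu j.1 j.2)

lemma IsStochasticConvolution.toL2_mem (hu : IsStochasticConvolution H κ W P u)
    (hW : IsFractionalNoise H W P) (i : ℝ≥0 × ℝ) : hu.toL2 i ∈ gaussianSpace W P :=
  (hu i.1 i.2).mem_gaussianSpace hW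

/-- If integrands `ψ n`, supported in consecutive time strips after `τ`, are orthogonal to the
kernels indexed by `S` but not to kernels at later times, then the closed span of the noise
contains an orthonormal sequence orthogonal to the stochastic convolution on `S`. -/
lemma exists_orthonormal_seq_of_innovation (hH : H ∈ Ioo (0 : ℝ) 1)
    (hW : IsFractionalNoise H W P) (hu : IsStochasticConvolution H κ W P u)
    (S : Set (ℝ≥0 × ℝ)) (τ : ℝ≥0) (y : ℝ) (ψ : ℕ → ℝ × ℝ → ℂ)
    (hψm : ∀ n, Measurable (ψ n))
    (hψle : ∀ (n : ℕ) p, ‖ψ n p‖ ≤ ‖spaceFourier (convKernel κ (τ + n + 1) y) p‖)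
    (hψ0 : ∀ (n : ℕ) p, p.1 ∉ Ioo (τ + n : ℝ) (τ + n + 1) → ψ n p = 0)
    (hS : ∀ n, ∀ i ∈ S, ∀ p,
      inner ℝ (ψ n p) (spaceFourier (convKernel κ (i.1 : ℝ) i.2) p) = 0)
    (hker : ∀ (t x : ℝ) p, ¬ p.1 < t → spaceFourier (convKernel κ t x) p = 0)
    (hpos : ∀ (n : ℕ) p, 0 ≤ inner ℝ (ψ n p) (spaceFourier (convKernel κ (τ + n + 1) y) p))
    (hpos' : ∀ n : ℕ, ∀ p ∈ Ioo (τ + n : ℝ) (τ + n + 1) ×ˢ Ioo (0 : ℝ) 1,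
      0 < inner ℝ (ψ n p) (spaceFourier (convKernel κ (τ + n + 1) y) p)) :
    ∃ Z : ℕ → Lp ℝ 2 P, Orthonormal ℝ Z ∧ (∀ n, Z n ∈ gaussianSpace W P) ∧
      ∀ n, ∀ i ∈ S, inner ℝ (Z n) (hu.toL2 i) = 0 := by
  have hF : ∀ n : ℕ, MemLp (spaceFourier (convKernel κ (τ + n + 1) y)) 2 (noiseMeasure H) := by
    intro n
    have := (hu (τ + n + 1) y).2.1
    simpa using this
  have hψ : ∀ n, MemLp (ψ n) 2 (noiseMeasure H) := fun n =>
    (hF n).of_le (hψm n).aestronglyMeasurable (Eventually.of_forall (hψle n))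
  have hval : ∀ n i, inner ℝ ((hψ n).toLp (ψ n)) (hu.kernelL2 i)
      = ∫ p, inner ℝ (ψ n p) (spaceFourier (convKernel κ (i.1 : ℝ) i.2) p)
        ∂(noiseMeasure H) := by
    intro n i
    rw [L2.inner_def]
    refine integral_congr_ae ?_
    filter_upwards [(hψ n).coeFn_toLp, hu.coeFn_kernelL2 i] with p h1 h2
    rw [h1, h2]
  refine exists_orthonormal_seq (hu.inner_toL2 hW) (gaussianSpace W P) (isClosed_gaussianSpace W)
    (hu.toL2_mem hW) S (fun n => (τ + n + 1, y)) (fun n => (hψ n).toLp (ψ n)) ?_ ?_ ?_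
  · intro n i hi
    rw [hval]
    simp [hS n i hi]
  · intro n k hk
    rw [hval]
    refine integral_eq_zero_of_ae (Eventually.of_forall fun p => ?_)
    have hk' : (k : ℝ) + 1 ≤ n := by exact_mod_cast hk
    simp only [Pi.zero_apply]
    -- For k < n the kernel at time τ + k + 1 ≤ τ + n vanishes on the n-th strip, where `ψ n` is
    -- supported.
    by_cases hp : p.1 ∈ Ioo (τ + n : ℝ) (τ + n + 1)
    · rw [hker _ _ p, inner_zero_right]
      have := hp.1
      push_cast
      linarith
    · rw [hψ0 n p hp, inner_zero_left]
  · intro n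
    have hi := L2.integrable_inner (𝕜 := ℝ) ((hψ n).toLp (ψ n)) ((hF n).toLp _)
    have hi' := hi.congr (g := fun p =>
        inner ℝ (ψ n p) (spaceFourier (convKernel κ (τ + n + 1) y) p)) (by
      filter_upwards [(hψ n).coeFn_toLp, (hF n).coeFn_toLp] with p h1 h2
      rw [h1, h2])
    rw [hval]
    push_cast
    refine ((integral_pos_iff_support_of_nonneg (hpos n) hi').2 ?_).ne'
    refine (noiseMeasure_Ioo_prod_pos hH (by positivity : (0 : ℝ) ≤ τ + n)
      (lt_add_one _)).trans_le (measure_mono fun p hp => ?_)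
    exact (hpos' n p hp).ne'

lemma measurable_convKernel (t x : ℝ) : Measurable (convKernel κ t x) := by
  unfold convKernel heatKernel
  exact Measurable.ite (measurableSet_lt measurable_fst measurable_const) (by fun_prop)
    (by fun_prop)

/-- All kernels at `x` transform to e^(-ixξ) times a real function, so e^(-ixξ) times an imaginary
function is pointwise orthogonal to them. Against the kernel at x + 1 the choice -i sin ξ yields
sin² ξ times a positive factor, which is positive for ξ in (0, 1). -/
lemma exists_orthonormal_seq_time (hH : H ∈ Ioo (0 : ℝ) 1) (hκ : 0 < κ)
    (hW : IsFractionalNoise H W P) (hu : IsStochasticConvolution H κ W P u) (x : ℝ) :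
    ∃ Z : ℕ → Lp ℝ 2 P, Orthonormal ℝ Z ∧ (∀ n, Z n ∈ gaussianSpace W P) ∧
      ∀ n, ∀ t : ℝ≥0, inner ℝ (Z n) (hu.toL2 (t, x)) = 0 := by
  have hE : ∀ a : ℝ, ‖Complex.exp (-(Complex.I * a))‖ = 1 := by
    intro a
    rw [show -(Complex.I * (a : ℂ)) = ((-a : ℝ) : ℂ) * Complex.I by push_cast; ring,
      Complex.norm_exp_ofReal_mul_I]
  have hprod : ∀ a b c d : ℝ, inner ℝ (Complex.exp (-(Complex.I * a)) * ((c : ℂ) * -Complex.I))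
      (Complex.exp (-(Complex.I * b)) * (d : ℂ)) = c * d * Real.sin (b - a) := by
    intro a b c d
    rw [Complex.inner, map_mul, ← Complex.exp_conj]
    have : Complex.exp (-(Complex.I * b)) * (d : ℂ) *
        (Complex.exp ((starRingEnd ℂ) (-(Complex.I * a))) *
          (starRingEnd ℂ) ((c : ℂ) * -Complex.I))
        = Complex.exp ((-(b - a) : ℝ) * Complex.I) * Complex.I * ((c * d : ℝ) : ℂ) := by
      have e : Complex.exp ((-(b - a) : ℝ) * Complex.I) = Complex.exp (-(Complex.I * b)) *
          Complex.exp ((starRingEnd ℂ) (-(Complex.I * a))) := by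
        rw [← Complex.exp_add]; congr 1; simp; ring
      rw [e]
      simp
      ring
    rw [this, Complex.re_mul_ofReal, Complex.mul_I_re, Complex.exp_ofReal_mul_I_im, Real.sin_neg]
    ring
  refine (exists_orthonormal_seq_of_innovation hH hW hu
    (range fun t : ℝ≥0 => (t, x)) 0 (x + 1)
    (fun n p => if p.1 ∈ Ioo (n : ℝ) (n + 1) then
      Complex.exp (-(Complex.I * (x * p.2 : ℝ))) *
        (((Real.sin p.2 * Real.exp (-(κ * (n + 1 - p.1) * p.2 ^ 2 / 2)) : ℝ) : ℂ) *
          -Complex.I) else 0) ?_ ?_ ?_ ?_ ?_ ?_ ?_).imp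
    fun Z h => ⟨h.1, h.2.1, fun n t => h.2.2 n _ (mem_range_self t)⟩
  · intro n
    exact Measurable.ite (measurable_fst measurableSet_Ioo) (by fun_prop) (by fun_prop)
  · intro n p
    rw [spaceFourier_convKernel hκ]
    simp only [NNReal.coe_zero, zero_add]
    by_cases hp : p.1 ∈ Ioo (n : ℝ) (n + 1)
    · rw [if_pos hp, if_pos hp.2, norm_mul, hE, norm_mul, norm_mul, hE, Complex.norm_real,
        Complex.norm_real, norm_neg, Complex.norm_I, norm_mul]
      have := Real.abs_sin_le_one p.2
      rw [Real.norm_eq_abs (Real.sin p.2)]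
      nlinarith [norm_nonneg (Real.exp (-(κ * (n + 1 - p.1) * p.2 ^ 2 / 2)))]
    · rw [if_neg hp, norm_zero]
      exact norm_nonneg _
  · intro n p hp
    simp only [NNReal.coe_zero, zero_add] at hp
    rw [if_neg hp]
  · rintro n _ ⟨t, rfl⟩ p
    rw [spaceFourier_convKernel hκ]
    split_ifs
    · simp only []
      rw [hprod]
      simp
    all_goals simp
  · intro t y p hp
    rw [spaceFourier_convKernel hκ, if_neg hp]
  · intro n p
    rw [spaceFourier_convKernel hκ]
    simp only [NNReal.coe_zero, zero_add]
    split_ifs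
    · rw [hprod, show (x + 1) * p.2 - x * p.2 = p.2 by ring]
      have := Real.exp_pos (-(κ * (n + 1 - p.1) * p.2 ^ 2 / 2))
      nlinarith [mul_nonneg (mul_self_nonneg (Real.sin p.2)) (mul_self_nonneg
        (Real.exp (-(κ * (n + 1 - p.1) * p.2 ^ 2 / 2))))]
    all_goals simp
  · intro n p hp
    simp only [NNReal.coe_zero, zero_add] at hp
    rw [spaceFourier_convKernel hκ]
    simp only [NNReal.coe_zero, zero_add]
    rw [if_pos hp.1, if_pos hp.1.2, hprod, show (x + 1) * p.2 - x * p.2 = p.2 by ring]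
    have hs : 0 < Real.sin p.2 := Real.sin_pos_of_pos_of_lt_pi hp.2.1
      (by linarith [hp.2.2, Real.pi_gt_three])
    positivity

/-- The kernels at time `t` vanish after `t`, so later kernels restricted to strips beyond `t` serve
as test functions. -/
lemma exists_orthonormal_seq_space (hH : H ∈ Ioo (0 : ℝ) 1) (hκ : 0 < κ)
    (hW : IsFractionalNoise H W P) (hu : IsStochasticConvolution H κ W P u) (t : ℝ≥0) :
    ∃ Z : ℕ → Lp ℝ 2 P, Orthonormal ℝ Z ∧ (∀ n, Z n ∈ gaussianSpace W P) ∧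
      ∀ n, ∀ x : ℝ, inner ℝ (Z n) (hu.toL2 (t, x)) = 0 := by
  refine (exists_orthonormal_seq_of_innovation hH hW hu
    (range fun x : ℝ => (t, x)) t 0
    (fun n p => if p.1 ∈ Ioo (t + n : ℝ) (t + n + 1) then
      spaceFourier (convKernel κ (t + n + 1) 0) p else 0) ?_ ?_ ?_ ?_ ?_ ?_ ?_).imp
    fun Z h => ⟨h.1, h.2.1, fun n x => h.2.2 n _ (mem_range_self x)⟩
  · intro n
    exact Measurable.ite (measurable_fst measurableSet_Ioo)
      (stronglyMeasurable_spaceFourier (measurable_convKernel _ _)).measurable (by fun_prop)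
  · intro n p
    split_ifs
    · exact le_rfl
    · simp
  · intro n p hp
    rw [if_neg hp]
  · rintro n _ ⟨x, rfl⟩ p
    split_ifs with hp
    · rw [spaceFourier_convKernel hκ t x, if_neg, inner_zero_right]
      have := hp.1
      have : (0 : ℝ) ≤ n := by positivity
      linarith
    · simp
  · intro r y p hp
    rw [spaceFourier_convKernel hκ, if_neg hp]
  · intro n p
    split_ifs
    · exact real_inner_self_nonneg
    · simp
  · intro n p hp
    rw [if_pos hp.1]
    refine real_inner_self_pos.2 ?_
    rw [spaceFourier_convKernel hκ, if_pos hp.1.2]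
    exact mul_ne_zero (Complex.exp_ne_zero _) (by exact_mod_cast (Real.exp_pos _).ne')

end Innovations

/-! ### Random power series. -/

section PowerSeries

lemma contDiffOn_tsum_mul_pow {c : ℕ → ℝ} {r : ℝ≥0∞} (hr : 0 < r)
    (hc : ∀ ρ : ℝ≥0, (ρ : ℝ≥0∞) < r → Summable fun n => |c n| * (ρ : ℝ) ^ n) :
    ContDiffOn ℝ ((⊤ : ℕ∞) : WithTop ℕ∞) (fun x => ∑' n, c n * x ^ n) (Metric.eball 0 r) := by
  set p := FormalMultilinearSeries.ofScalars ℝ c with hp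
  have hrad : r ≤ p.radius := by
    refine ENNReal.le_of_forall_nnreal_lt fun ρ hρ => ?_
    refine p.le_radius_of_summable ?_
    simpa [hp, FormalMultilinearSeries.ofScalars_norm] using hc ρ hρ
  have h := (p.hasFPowerSeriesOnBall (hr.trans_le hrad)).mono hr hrad
  have h2 : p.sum = fun x => ∑' n, c n * x ^ n := by
    ext x
    change FormalMultilinearSeries.ofScalarsSum c x = _
    rw [FormalMultilinearSeries.ofScalars_sum_eq]
    simp
  rw [← h2]
  exact h.analyticOnNhd.contDiffOn (Metric.isOpen_eball.uniqueDiffOn)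

variable {Ω : Type*} [MeasurableSpace Ω] {P : Measure Ω}

lemma ae_hasSum_of_summable_norm {f : ℕ → Lp ℝ 2 P} (hf : Summable fun n => ‖f n‖) :
    ∀ᵐ ω ∂P, HasSum (fun n => f n ω) ((∑' n, f n : Lp ℝ 2 P) ω) ∧
      Summable fun n => |f n ω| := by
  have h : ∑' n, ‖f n‖ₑ ≠ ∞ := tsum_enorm_ne_top_iff_summable_norm.2 hf
  have h2 := summable_norm_of_tsum_eLpNorm_ne_top (p := 2) one_le_two
    (fun n => Lp.aestronglyMeasurable (f n)) (by simpa [Lp.enorm_def] using h)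
  filter_upwards [Lp.hasSum_coeFn_tsum h, h2] with ω h1 h2
  exact ⟨h1, h2⟩

/-- Rational radii suffice by comparison, which leaves one null set for all `ρ`. -/
lemma ae_summable_mul_pow {r : ℝ≥0∞} {f : ℕ → Lp ℝ 2 P}
    (hf : ∀ ρ : ℝ≥0, (ρ : ℝ≥0∞) < r → Summable fun n => ‖f n‖ * (ρ : ℝ) ^ n) :
    ∀ᵐ ω ∂P, ∀ ρ : ℝ≥0, (ρ : ℝ≥0∞) < r → Summable fun n => |f n ω| * (ρ : ℝ) ^ n := by
  have h1 : ∀ᵐ ω ∂P, ∀ q : ℚ, 0 ≤ q → ENNReal.ofReal q < r →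
      Summable fun n => |f n ω| * (q : ℝ) ^ n := by
    rw [ae_all_iff]
    intro q
    rw [eventually_imp_distrib_left]
    intro hq
    rw [eventually_imp_distrib_left]
    intro hqr
    have hq' : (0 : ℝ) ≤ q := by exact_mod_cast hq
    have h2 := hf (Real.toNNReal q) hqr
    rw [Real.coe_toNNReal _ hq'] at h2
    have h3 : Summable fun n => ‖(q : ℝ) ^ n • f n‖ := by
      refine h2.congr fun n => ?_
      rw [norm_smul, Real.norm_of_nonneg (by positivity), mul_comm]
    have h4 : ∀ᵐ ω ∂P, ∀ n, ((q : ℝ) ^ n • f n : Lp ℝ 2 P) ω = (q : ℝ) ^ n * f n ω := by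
      rw [ae_all_iff]
      intro n
      filter_upwards [Lp.coeFn_smul ((q : ℝ) ^ n) (f n)] with ω h
      rw [h]; rfl
    filter_upwards [ae_hasSum_of_summable_norm h3, h4] with ω h5 h6
    refine h5.2.congr fun n => ?_
    rw [h6, abs_mul, abs_of_nonneg (by positivity : (0 : ℝ) ≤ (q : ℝ) ^ n), mul_comm]
  filter_upwards [h1] with ω hω ρ hρ
  obtain ⟨q, hq1, hq2⟩ := ENNReal.lt_iff_exists_nnreal_btwn.1 hρ
  obtain ⟨q', hq3, hq4⟩ := exists_rat_btwn (show (ρ : ℝ) < q by exact_mod_cast hq1)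
  have hq0 : (0 : ℝ) < q' := lt_of_le_of_lt ρ.2 hq3
  refine Summable.of_nonneg_of_le (fun n => by positivity) (fun n => ?_)
    (hω q' (by exact_mod_cast hq0.le) (lt_of_lt_of_le ?_ hq2.le))
  · gcongr
  · rw [ENNReal.ofReal, ENNReal.coe_lt_coe]
    exact (Real.toNNReal_lt_iff_lt_coe hq0.le).2 hq4

/-- A random power series whose coefficient norms in `L²(P)` have radius of convergence at least
`r` has a version that is smooth on the ball of radius `r`. -/
lemma exists_randomPowerSeries {r : ℝ≥0∞} (hr : 0 < r) {f : ℕ → Lp ℝ 2 P}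
    (hf : ∀ ρ : ℝ≥0, (ρ : ℝ≥0∞) < r → Summable fun n => ‖f n‖ * (ρ : ℝ) ^ n) :
    ∃ c : ℕ → Ω → ℝ, (∀ᵐ ω ∂P, ∀ n, c n ω = f n ω) ∧
      (∀ ω, ∀ ρ : ℝ≥0, (ρ : ℝ≥0∞) < r → Summable fun n => |c n ω| * (ρ : ℝ) ^ n) ∧
      (∀ ω, ContDiffOn ℝ ((⊤ : ℕ∞) : WithTop ℕ∞) (fun x => ∑' n, c n ω * x ^ n)
        (Metric.eball 0 r)) := by
  classical
  -- Coefficients are replaced by 0 off `A`, so smoothness holds for every `ω` and not only almost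
  -- surely.
  set A : Set Ω := {ω | ∀ ρ : ℝ≥0, (ρ : ℝ≥0∞) < r → Summable fun n => |f n ω| * (ρ : ℝ) ^ n}
  have hA : ∀ᵐ ω ∂P, ω ∈ A := ae_summable_mul_pow hf
  have hs : ∀ ω, ∀ ρ : ℝ≥0, (ρ : ℝ≥0∞) < r →
      Summable fun n => |if ω ∈ A then f n ω else 0| * (ρ : ℝ) ^ n := by
    intro ω ρ hρ
    by_cases hω : ω ∈ A
    · simpa [hω] using hω ρ hρ
    · simp [hω, summable_zero]
  refine ⟨fun n ω => if ω ∈ A then f n ω else 0, ?_, hs, fun ω => ?_⟩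
  · filter_upwards [hA] with ω hω n
    rw [if_pos hω]
  · exact contDiffOn_tsum_mul_pow hr (hs ω)

end PowerSeries

/-! ### Moments of the spectral measure of the spatial correction. -/

section GaussianMoments

variable {H κ : ℝ}

/-- The spectral measure of the smooth correction in space. -/
noncomputable def tailMeasure (H κ t : ℝ) : Measure ℝ :=
  volume.withDensity fun ξ =>
    ENNReal.ofReal (c1 H / κ * (|ξ| ^ (-1 - 2 * H) * Real.exp (-(κ * t * ξ ^ 2))))

lemma integral_tailMeasure (hH : H ∈ Ioo (0 : ℝ) 1) (hκ : 0 < κ) (t : ℝ) (f : ℝ → ℝ) :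
    ∫ ξ, f ξ ∂(tailMeasure H κ t)
      = ∫ ξ, c1 H / κ * (|ξ| ^ (-1 - 2 * H) * Real.exp (-(κ * t * ξ ^ 2))) * f ξ := by
  unfold tailMeasure
  rw [integral_withDensity_eq_integral_toReal_smul₀ (by fun_prop) (by simp)]
  refine integral_congr_ae (Eventually.of_forall fun ξ => ?_)
  have := (c1_pos hH).le
  simp only [smul_eq_mul]
  rw [ENNReal.toReal_ofReal (by positivity)]

lemma integrable_tailMeasure (hH : H ∈ Ioo (0 : ℝ) 1) (hκ : 0 < κ) (t : ℝ) (f : ℝ → ℝ) :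
    Integrable f (tailMeasure H κ t) ↔ Integrable fun ξ =>
      c1 H / κ * (|ξ| ^ (-1 - 2 * H) * Real.exp (-(κ * t * ξ ^ 2))) * f ξ := by
  unfold tailMeasure
  rw [integrable_withDensity_iff_integrable_smul₀' (by fun_prop) (by simp)]
  refine integrable_congr (Eventually.of_forall fun ξ => ?_)
  have := (c1_pos hH).le
  simp only [smul_eq_mul]
  rw [ENNReal.toReal_ofReal (by positivity)]

lemma tail_density_mul_pow_ae (n : ℕ) (C b : ℝ) :
    (fun ξ : ℝ => C * (|ξ| ^ (-1 - 2 * H) * Real.exp (-(b * ξ ^ 2))) * (ξ ^ (n + 1)) ^ 2)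
      =ᵐ[volume] fun ξ => C * (|ξ| ^ (2 * n + 1 - 2 * H) * Real.exp (-(b * ξ ^ 2))) := by
  have hne : ∀ᵐ ξ : ℝ, ξ ≠ 0 := by simp [ae_iff]
  filter_upwards [hne] with ξ hξ
  have h1 : 0 < |ξ| := abs_pos.2 hξ
  have h2 : (ξ ^ (n + 1)) ^ 2 = |ξ| ^ (2 * n + 2 : ℝ) := by
    rw [← sq_abs (ξ ^ (n + 1)), abs_pow, ← pow_mul, ← Real.rpow_natCast]
    congr 1
    push_cast
    ring
  have h3 : |ξ| ^ (2 * n + 1 - 2 * H : ℝ) = |ξ| ^ (-1 - 2 * H) * |ξ| ^ (2 * n + 2 : ℝ) := by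
    rw [← Real.rpow_add h1]
    congr 1
    ring
  rw [h2, h3]
  generalize |ξ| ^ (2 * n + 2 : ℝ) = v
  ring

/-- The measure is infinite near 0. One factor ξ is enough to compensate, since 2n + 1 - 2H > -1 for
all n ≥ 0; this is why powers start at 1. -/
lemma memLp_pow_tailMeasure (hH : H ∈ Ioo (0 : ℝ) 1) (hκ : 0 < κ) {t : ℝ} (ht : 0 < t) (n : ℕ) :
    MemLp (fun ξ : ℝ => ξ ^ (n + 1)) 2 (tailMeasure H κ t) := by
  rw [memLp_two_iff_integrable_sq (by fun_prop), integrable_tailMeasure hH hκ]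
  refine Integrable.congr ?_ (tail_density_mul_pow_ae n _ _).symm
  refine (integrable_abs_rpow_mul_exp ?_ (by positivity)).const_mul _
  have := hH.2
  have : (0 : ℝ) ≤ n := by positivity
  linarith

lemma Gamma_nat_add_one_sub_le (hH : H ∈ Ioo (0 : ℝ) 1) (n : ℕ) :
    Real.Gamma (n + 1 - H) ≤ n.factorial * Real.Gamma (1 - H) := by
  induction n with
  | zero => simp
  | succ n ih =>
    have h0 : (0 : ℝ) ≤ n := by positivity
    have hpos : (n : ℝ) + 1 - H ≠ 0 := by linarith [hH.2]
    have hG := Real.Gamma_pos_of_pos (show 0 < (n : ℝ) + 1 - H by linarith [hH.2])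
    rw [show ((n + 1 : ℕ) : ℝ) + 1 - H = ((n : ℝ) + 1 - H) + 1 by push_cast; ring,
      Real.Gamma_add_one hpos, Nat.factorial_succ]
    push_cast
    rw [mul_assoc]
    have h1 := hH.1
    exact mul_le_mul (by linarith) ih hG.le (by positivity)

/-- Up to geometric factors the norm grows at most like √(n!), which the Taylor coefficients, of
order 1/(n+1)!, overcome. -/
lemma norm_pow_tailMeasure (hH : H ∈ Ioo (0 : ℝ) 1) (hκ : 0 < κ) {t : ℝ} (ht : 0 < t) (n : ℕ) :
    ‖(memLp_pow_tailMeasure hH hκ ht n).toLp (fun ξ : ℝ => ξ ^ (n + 1))‖ ^ 2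
      ≤ c1 H / κ * Real.Gamma (1 - H) * (κ * t) ^ (H - 1) * ((κ * t)⁻¹ ^ n * n.factorial) := by
  have hc := c1_pos hH
  have hb : 0 < κ * t := by positivity
  have hq : (-1 : ℝ) < 2 * n + 1 - 2 * H := by
    have := hH.2
    have : (0 : ℝ) ≤ n := by positivity
    linarith
  rw [← integral_sq_eq_norm_sq]
  have h1 : ∫ ξ, (memLp_pow_tailMeasure hH hκ ht n).toLp (fun ξ : ℝ => ξ ^ (n + 1)) ξ ^ 2
        ∂(tailMeasure H κ t)
      = ∫ ξ, (ξ ^ (n + 1)) ^ 2 ∂(tailMeasure H κ t) := by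
    refine integral_congr_ae ?_
    filter_upwards [(memLp_pow_tailMeasure hH hκ ht n).coeFn_toLp] with ξ h
    rw [h]
  rw [h1, integral_tailMeasure hH hκ, integral_congr_ae (tail_density_mul_pow_ae n _ _),
    integral_const_mul, integral_abs_rpow_mul_exp hq hb,
    show -(2 * (n : ℝ) + 1 - 2 * H + 1) / 2 = (H - 1) + -n by ring,
    show (2 * (n : ℝ) + 1 - 2 * H + 1) / 2 = n + 1 - H by ring, Real.rpow_add hb,
    Real.rpow_neg hb.le, Real.rpow_natCast, inv_pow]
  have h2 := Gamma_nat_add_one_sub_le hH n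
  calc _ = c1 H / κ * (κ * t) ^ (H - 1) * ((κ * t) ^ n)⁻¹ * Real.Gamma (n + 1 - H) := by ring
    _ ≤ c1 H / κ * (κ * t) ^ (H - 1) * ((κ * t) ^ n)⁻¹ *
        (n.factorial * Real.Gamma (1 - H)) := by gcongr
    _ = _ := by ring

/-- Arithmetic–geometric mean applied to b_n = 2^(-n) · (2^n b_n). -/
lemma summable_of_sq_le {b : ℕ → ℝ} {C q : ℝ} (hb : ∀ n, 0 ≤ b n)
    (h : ∀ n, b n ^ 2 ≤ C * (q ^ n / n.factorial)) : Summable b := by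
  have h1 : Summable fun n : ℕ => (1 / 4 : ℝ) ^ n + C * ((4 * q) ^ n / n.factorial) :=
    (summable_geometric_of_lt_one (by norm_num) (by norm_num)).add
      ((Real.summable_pow_div_factorial (4 * q)).mul_left C)
  refine Summable.of_nonneg_of_le hb (fun n => ?_) h1
  have h2 : C * ((4 * q) ^ n / n.factorial) = 4 ^ n * (C * (q ^ n / n.factorial)) := by
    rw [mul_pow]; ring
  have h3 : (4 : ℝ) ^ n * b n ^ 2 ≤ 4 ^ n * (C * (q ^ n / n.factorial)) := by
    gcongr
    exact h n
  have h4 : (1 / 4 : ℝ) ^ n = ((1 / 2) ^ n) ^ 2 := by rw [← pow_mul, mul_comm, pow_mul]; norm_num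
  have h5 : (4 : ℝ) ^ n * b n ^ 2 = (2 ^ n * b n) ^ 2 := by
    rw [mul_pow, ← pow_mul, mul_comm n 2, pow_mul]; norm_num
  have h6 : (1 / 2 : ℝ) ^ n * (2 ^ n * b n) = b n := by
    rw [← mul_assoc, ← mul_pow]; norm_num
  rw [h2, h4]
  nlinarith [sq_nonneg ((1 / 2 : ℝ) ^ n - 2 ^ n * b n), hb n]

end GaussianMoments

/-! ### The smooth correction in space. -/

section SpaceCorrection

/-- The Taylor coefficients of `(cos y + sin y - 1) / y`. -/
noncomputable def casCoeff (n : ℕ) : ℝ :=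
  (((n + 1).factorial : ℂ)⁻¹ * ((1 - Complex.I) * Complex.I ^ (n + 1))).re

lemma abs_casCoeff_le (n : ℕ) : |casCoeff n| ≤ 2 / (n + 1).factorial := by
  refine (Complex.abs_re_le_norm _).trans ?_
  rw [norm_mul, norm_mul, norm_pow, Complex.norm_I, one_pow, mul_one, norm_inv, Complex.norm_natCast,
    inv_mul_eq_div]
  gcongr
  refine (norm_sub_le _ _).trans ?_
  simp
  norm_num

lemma hasSum_casCoeff (y : ℝ) :
    HasSum (fun n => casCoeff n * y ^ (n + 1)) (Real.cos y + Real.sin y - 1) := by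
  have h1 := (NormedSpace.expSeries_div_hasSum_exp (𝔸 := ℂ) ((y : ℂ) * Complex.I)).mul_left
    (1 - Complex.I)
  rw [← Complex.exp_eq_exp_ℂ] at h1
  have h2 := Complex.hasSum_re h1
  have h3 := (hasSum_nat_add_iff' 1).2 h2
  have e1 : ∀ n, casCoeff n * y ^ (n + 1)
      = ((1 - Complex.I) * (((y : ℂ) * Complex.I) ^ (n + 1) / ((n + 1).factorial : ℂ))).re := by
    intro n
    rw [casCoeff, ← Complex.re_mul_ofReal]
    congr 1
    push_cast
    ring
  have e2 : Real.cos y + Real.sin y - 1 = ((1 - Complex.I) * Complex.exp (y * Complex.I)).re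
      - ∑ i ∈ Finset.range 1,
        ((1 - Complex.I) * (((y : ℂ) * Complex.I) ^ i / (i.factorial : ℂ))).re := by
    simp [Complex.exp_ofReal_mul_I_re, Complex.exp_ofReal_mul_I_im]
  simp_rw [e1]
  rw [e2]
  exact h3

variable {H κ : ℝ}

/-- The vector `h x` is the function cos(xξ) + sin(xξ) - 1, a real substitute for e^(ixξ) - 1 with
the same increments in norm because the measure is even. Its Taylor series in x converges in L² for
every x. -/
lemma exists_casSeries (hH : H ∈ Ioo (0 : ℝ) 1) (hκ : 0 < κ) {t : ℝ} (ht : 0 < t) :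
    ∃ (g : ℕ → Lp ℝ 2 (tailMeasure H κ t)) (h : ℝ → Lp ℝ 2 (tailMeasure H κ t)),
      (∀ ρ : ℝ, Summable fun n => ‖g n‖ * ρ ^ n) ∧
      (∀ x, h x = ∑' n, x ^ (n + 1) • g n) ∧
      (∀ x y, Integrable (fun ξ => c1 H / κ * (|ξ| ^ (-1 - 2 * H) * Real.exp (-(κ * t * ξ ^ 2))) *
        (2 * (1 - Real.cos ((x - y) * ξ)))) ∧
        ‖h x - h y‖ ^ 2 = ∫ ξ, c1 H / κ * (|ξ| ^ (-1 - 2 * H) * Real.exp (-(κ * t * ξ ^ 2))) *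
        (2 * (1 - Real.cos ((x - y) * ξ)))) := by
  set g : ℕ → Lp ℝ 2 (tailMeasure H κ t) := fun n =>
    casCoeff n • (memLp_pow_tailMeasure hH hκ ht n).toLp (fun ξ : ℝ => ξ ^ (n + 1)) with hg
  have hsum0 : ∀ ρ : ℝ, 0 ≤ ρ → Summable fun n => ‖g n‖ * ρ ^ n := by
    intro ρ hρ
    refine summable_of_sq_le (C := 4 * (c1 H / κ * Real.Gamma (1 - H) * (κ * t) ^ (H - 1)))
      (q := (κ * t)⁻¹ * ρ ^ 2) (fun n => by positivity) fun n => ?_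
    have h1 := norm_pow_tailMeasure hH hκ ht n
    have h2 := abs_casCoeff_le n
    have hc := c1_pos hH
    have hG := Real.Gamma_pos_of_pos (show 0 < 1 - H by linarith [hH.2])
    set D := c1 H / κ * Real.Gamma (1 - H) * (κ * t) ^ (H - 1) with hD
    have hD0 : 0 ≤ D := by positivity
    have h3 : |casCoeff n| ^ 2 ≤ (2 / (n.factorial : ℝ)) ^ 2 := by
      refine pow_le_pow_left₀ (abs_nonneg _) (h2.trans ?_) 2
      gcongr
      exact Nat.le_succ n
    rw [hg]
    simp only []
    rw [norm_smul, Real.norm_eq_abs, mul_pow, mul_pow]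
    calc _ ≤ (2 / (n.factorial : ℝ)) ^ 2 * (D * ((κ * t)⁻¹ ^ n * n.factorial)) * (ρ ^ n) ^ 2 := by
          gcongr
      _ = _ := by
          have : (n.factorial : ℝ) ≠ 0 := by positivity
          field_simp
          ring
  have hsum : ∀ ρ : ℝ, Summable fun n => ‖g n‖ * ρ ^ n := by
    intro ρ
    refine Summable.of_norm ((hsum0 |ρ| (abs_nonneg _)).congr fun n => ?_)
    simp
  refine ⟨g, fun x => ∑' n, x ^ (n + 1) • g n, hsum, fun x => rfl, fun x y => ?_⟩
  have hnorm : ∀ x : ℝ, Summable fun n => ‖x ^ (n + 1) • g n‖ := by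
    intro x
    refine ((hsum |x|).mul_left |x|).congr fun n => ?_
    rw [norm_smul (x ^ (n + 1)) (g n), norm_pow, Real.norm_eq_abs, pow_succ]
    ring
  have hval : ∀ x : ℝ, (∑' n, x ^ (n + 1) • g n : Lp ℝ 2 (tailMeasure H κ t))
      =ᵐ[tailMeasure H κ t] fun ξ => Real.cos (x * ξ) + Real.sin (x * ξ) - 1 := by
    intro x
    have h4 : ∀ᵐ ξ ∂(tailMeasure H κ t), ∀ n,
        (x ^ (n + 1) • g n : Lp ℝ 2 (tailMeasure H κ t)) ξ
          = casCoeff n * (x * ξ) ^ (n + 1) := by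
      rw [ae_all_iff]
      intro n
      filter_upwards [Lp.coeFn_smul (x ^ (n + 1)) (g n), Lp.coeFn_smul (casCoeff n)
        ((memLp_pow_tailMeasure hH hκ ht n).toLp (fun ξ : ℝ => ξ ^ (n + 1))),
        (memLp_pow_tailMeasure hH hκ ht n).coeFn_toLp] with ξ h1 h2 h3
      rw [h1, Pi.smul_apply, h2, Pi.smul_apply, h3, smul_eq_mul, smul_eq_mul, mul_pow]
      ring
    filter_upwards [ae_hasSum_of_summable_norm (hnorm x), h4] with ξ h5 h6
    simp only [h6] at h5
    exact h5.1.unique (hasSum_casCoeff (x * ξ))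
  set f : ℝ → ℝ := fun ξ => (Real.cos (x * ξ) + Real.sin (x * ξ)
    - (Real.cos (y * ξ) + Real.sin (y * ξ))) ^ 2 with hf
  have hdiff : (fun ξ => ((∑' n, x ^ (n + 1) • g n) - (∑' n, y ^ (n + 1) • g n) :
      Lp ℝ 2 (tailMeasure H κ t)) ξ ^ 2) =ᵐ[tailMeasure H κ t] f := by
    filter_upwards [Lp.coeFn_sub (∑' n, x ^ (n + 1) • g n) (∑' n, y ^ (n + 1) • g n),
      hval x, hval y] with ξ h1 h2 h3
    rw [h1, Pi.sub_apply, h2, h3, hf]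
    ring
  have hint : Integrable f (tailMeasure H κ t) := (Lp.memLp _).integrable_sq.congr hdiff
  rw [integrable_tailMeasure hH hκ] at hint
  -- Averaging over ξ and -ξ removes the mixed sine–cosine terms.
  have hsym : ∀ ξ : ℝ, c1 H / κ * (|ξ| ^ (-1 - 2 * H) * Real.exp (-(κ * t * ξ ^ 2))) *
        (2 * (1 - Real.cos ((x - y) * ξ)))
      = 1 / 2 * (c1 H / κ * (|ξ| ^ (-1 - 2 * H) * Real.exp (-(κ * t * ξ ^ 2))) * f ξ +
        c1 H / κ * (|-ξ| ^ (-1 - 2 * H) * Real.exp (-(κ * t * (-ξ) ^ 2))) * f (-ξ)) := by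
    intro ξ
    rw [abs_neg, neg_sq, ← mul_add]
    have e : f ξ + f (-ξ) = 2 * (2 * (1 - Real.cos ((x - y) * ξ))) := by
      simp only [hf, mul_neg, Real.cos_neg, Real.sin_neg, sub_mul, Real.cos_sub]
      nlinarith [Real.sin_sq_add_cos_sq (x * ξ), Real.sin_sq_add_cos_sq (y * ξ)]
    rw [e]
    ring
  simp_rw [hsym]
  refine ⟨(hint.add hint.comp_neg).const_mul _, ?_⟩
  rw [← integral_sq_eq_norm_sq, integral_congr_ae hdiff, integral_tailMeasure hH hκ,
    integral_const_mul, integral_add hint hint.comp_neg,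
    integral_neg_eq_self (μ := volume) (fun ξ : ℝ =>
      c1 H / κ * (|ξ| ^ (-1 - 2 * H) * Real.exp (-(κ * t * ξ ^ 2))) * f ξ)]
  ring

variable {Ω : Type*} [MeasurableSpace Ω] {P : Measure Ω} [IsProbabilityMeasure P]
  {W : 𝓓(halfPlane, ℝ) → Ω → ℝ} {u : ℝ≥0 → ℝ → Ω → ℝ}

omit [IsProbabilityMeasure P] in
lemma IsStochasticConvolution.norm_sub_space (hu : IsStochasticConvolution H κ W P u)
    (hH : H ∈ Ioo (0 : ℝ) 1) (hκ : 0 < κ) (hW : IsFractionalNoise H W P) (t : ℝ≥0) (x y : ℝ) :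
    Integrable (fun ξ => spectralDensity H κ t ξ * (2 * (1 - Real.cos ((x - y) * ξ)))) ∧
    ‖hu.toL2 (t, x) - hu.toL2 (t, y)‖ ^ 2
      = ∫ ξ, spectralDensity H κ t ξ * (2 * (1 - Real.cos ((x - y) * ξ))) := by
  have key : ∀ a b : ℝ, Integrable (fun ξ => spectralDensity H κ t ξ * Real.cos ((a - b) * ξ)) ∧
      inner ℝ (hu.toL2 (t, a)) (hu.toL2 (t, b))
        = ∫ ξ, spectralDensity H κ t ξ * Real.cos ((a - b) * ξ) := by
    intro a b
    rw [hu.inner_toL2 hW]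
    exact inner_convKernel_space hH hκ t.2 a b _ _
  have hself : ∀ a : ℝ, ‖hu.toL2 (t, a)‖ ^ 2 = ∫ ξ, spectralDensity H κ t ξ := by
    intro a
    rw [← real_inner_self_eq_norm_sq, (key a a).2]
    simp
  have hspec : Integrable fun ξ => spectralDensity H κ t ξ := by simpa using (key x x).1
  have e : ∀ ξ, spectralDensity H κ t ξ * (2 * (1 - Real.cos ((x - y) * ξ)))
      = 2 * spectralDensity H κ t ξ - 2 * (spectralDensity H κ t ξ * Real.cos ((x - y) * ξ)) := by
    intro ξ; ring
  simp_rw [e]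
  refine ⟨(hspec.const_mul 2).sub ((key x y).1.const_mul 2), ?_⟩
  rw [integral_sub (hspec.const_mul 2) ((key x y).1.const_mul 2), integral_const_mul,
    integral_const_mul, @norm_sub_sq_real, hself, hself, (key x y).2]
  ring

omit [IsProbabilityMeasure P] in
/-- An orthogonal random field with entire sample paths whose addition turns the increments of
the stochastic convolution at time `t` into those of fractional Brownian motion. -/
lemma exists_spaceCorrection (hH : H ∈ Ioo (0 : ℝ) 1) (hκ : 0 < κ)
    (hW : IsFractionalNoise H W P) (hu : IsStochasticConvolution H κ W P u) {t : ℝ≥0}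
    (ht : 0 < t) :
    ∃ (Y : ℝ → Lp ℝ 2 P) (V : ℝ → Ω → ℝ), (∀ x, Y x ∈ gaussianSpace W P) ∧
      (∀ x, Y x =ᵐ[P] V x) ∧ (∀ ω, V 0 ω = 0) ∧
      (∀ ω, ContDiff ℝ ((⊤ : ℕ∞) : WithTop ℕ∞) fun x => V x ω) ∧
      ∀ x y, ‖(hu.toL2 (t, x) + Y x) - (hu.toL2 (t, y) + Y y)‖ ^ 2
        = κ⁻¹ * |x - y| ^ (2 * H) := by
  have ht' : (0 : ℝ) < t := ht
  obtain ⟨Z, hZ, hZW, hZu⟩ := exists_orthonormal_seq_space hH hκ hW hu t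
  obtain ⟨g, h, hg, hh, hhn⟩ := exists_casSeries hH hκ ht'
  have : Fact ((2 : ℝ≥0∞) ≠ ∞) := ⟨by norm_num⟩
  have : SFinite (tailMeasure H κ t) := by unfold tailMeasure; infer_instance
  set K : Submodule ℝ (Lp ℝ 2 P) :=
    gaussianSpace W P ⊓ (Submodule.span ℝ (range fun x : ℝ => hu.toL2 (t, x)))ᗮ with hK
  have hKc : IsClosed (K : Set (Lp ℝ 2 P)) :=
    (isClosed_gaussianSpace W).inter (Submodule.isClosed_orthogonal _)
  have hZK : ∀ n, Z n ∈ K := by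
    refine fun n => ⟨hZW n, (Submodule.mem_orthogonal' _ _).2 fun v hv => ?_⟩
    induction hv using Submodule.span_induction with
    | mem v h => obtain ⟨x, rfl⟩ := h; exact hZu n x
    | zero => exact inner_zero_right _
    | add a b _ _ ha hb => rw [inner_add_right, ha, hb, add_zero]
    | smul c a _ ha => rw [real_inner_smul_right, ha, mul_zero]
  -- `T` realises L² of the spectral measure by Gaussian variables independent of `u` at time `t`.
  obtain ⟨T, hT⟩ := exists_linearIsometry_of_orthonormal (F := Lp ℝ 2 (tailMeasure H κ t))
    hZ K hKc hZK
  obtain ⟨c, hc1, hc2, hc3⟩ := exists_randomPowerSeries (P := P) (r := ∞) (f := fun n => T (g n))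
    (by simp) (fun ρ _ => by simpa using hg ρ)
  have hnorm : ∀ x : ℝ, Summable fun n => ‖x ^ (n + 1) • T (g n)‖ := by
    intro x
    refine ((hg |x|).mul_left |x|).congr fun n => ?_
    rw [norm_smul, norm_pow, Real.norm_eq_abs, pow_succ, T.norm_map]
    ring
  have hTh : ∀ x, T (h x) = ∑' n, x ^ (n + 1) • T (g n) := by
    intro x
    have hs : Summable fun n => x ^ (n + 1) • g n := by
      refine Summable.of_norm ((hnorm x).congr fun n => ?_)
      rw [norm_smul, norm_smul, T.norm_map]
    rw [hh]
    have := T.toContinuousLinearMap.map_tsum hs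
    simpa using this
  refine ⟨fun x => T (h x), fun x ω => x * ∑' n, c n ω * x ^ n, fun x => (hT _).1, fun x => ?_,
    fun ω => by simp, fun ω => ?_, fun x y => ?_⟩
  · simp only [hTh]
    have h4 : ∀ᵐ ω ∂P, ∀ n, (x ^ (n + 1) • T (g n) : Lp ℝ 2 P) ω
        = x ^ (n + 1) * T (g n) ω := by
      rw [ae_all_iff]
      intro n
      filter_upwards [Lp.coeFn_smul (x ^ (n + 1)) (T (g n))] with ω h
      rw [h]; rfl
    filter_upwards [ae_hasSum_of_summable_norm (hnorm x), h4, hc1] with ω h5 h6 h7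
    rw [← h5.1.tsum_eq, ← tsum_mul_left]
    refine tsum_congr fun n => ?_
    rw [h6, h7]
    ring
  · have := hc3 ω
    rw [Metric.eball_top, contDiffOn_univ] at this
    exact contDiff_id.mul this
  · have horth : inner ℝ (hu.toL2 (t, x) - hu.toL2 (t, y)) (T (h x - h y)) = 0 := by
      refine (Submodule.mem_orthogonal _ _).1 (hT (h x - h y)).2 _ ?_
      exact Submodule.sub_mem _ (Submodule.subset_span (mem_range_self x))
        (Submodule.subset_span (mem_range_self y))
    rw [add_sub_add_comm, ← map_sub, @norm_add_sq_real, horth, T.norm_map, mul_zero, add_zero,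
      (hu.norm_sub_space hH hκ hW t x y).2, (hhn x y).2,
      ← integral_add (hu.norm_sub_space hH hκ hW t x y).1 (hhn x y).1,
      ← integral_one_sub_cos_mul_abs_rpow hH, ← integral_const_mul]
    -- The factors 1 - e^(-κtξ²) and e^(-κtξ²) add up to 1, leaving the fBm density divided by κ.
    have hne : ∀ᵐ ξ : ℝ, ξ ≠ 0 := by simp [ae_iff]
    refine integral_congr_ae ?_
    filter_upwards [hne] with ξ hξ
    have h1 : 0 < |ξ| := abs_pos.2 hξ
    have h2 : |ξ| ^ (1 - 2 * H) = |ξ| ^ (-1 - 2 * H) * ξ ^ 2 := by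
      rw [← sq_abs, ← Real.rpow_natCast, ← Real.rpow_add h1]
      congr 1
      push_cast
      ring
    rw [spectralDensity, h2]
    field_simp
    ring

end SpaceCorrection

/-! ### Diagonal expansion of (r + s)^(-(2-H)). -/

section CayleyExpansion

variable {H : ℝ}

/-- The Taylor coefficients of `(1 - z) ^ (-(2 - H))`. -/
noncomputable def binCoeff (H : ℝ) (n : ℕ) : ℝ := Ring.choose (2 - H + n - 1) n

/-- The Cayley transform of the half line onto the interval `(-1, 1)`. -/
noncomputable def cayley (r : ℝ) : ℝ := (r - 1) / (r + 1)

/-- The weight in the diagonal expansion of `(r + s) ^ (-(2 - H))`. -/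
noncomputable def cayleyWeight (H r : ℝ) : ℝ := 2 ^ ((2 - H) / 2) * (r + 1) ^ (-(2 - H))

lemma binCoeff_nonneg (hH : H ∈ Ioo (0 : ℝ) 1) (n : ℕ) : 0 ≤ binCoeff H n := by
  have h1 := Ring.factorial_nsmul_multichoose_eq_ascPochhammer (2 - H) n
  rw [Ring.multichoose_eq, Polynomial.ascPochhammer_smeval_eq_eval, nsmul_eq_mul] at h1
  have h2 := ascPochhammer_pos n (2 - H) (by linarith [hH.2])
  rw [← h1] at h2
  exact (pos_of_mul_pos_right h2 (by positivity)).le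

lemma hasSum_binCoeff {z : ℝ} (hz : |z| < 1) :
    HasSum (fun n => binCoeff H n * z ^ n) (1 / (1 - z) ^ (2 - H)) := by
  have h := (Real.one_div_one_sub_rpow_hasFPowerSeriesOnBall_zero (2 - H)).hasSum (y := z) (by
    rw [Metric.mem_eball, edist_zero_right, Real.enorm_eq_ofReal_abs]
    exact ENNReal.ofReal_lt_one.2 hz)
  simpa [binCoeff, mul_comm] using h

lemma summable_binCoeff_mul_pow {z : ℝ} (hz : |z| < 1) :
    Summable fun n => binCoeff H n * z ^ n := (hasSum_binCoeff hz).summable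

lemma abs_cayley_lt_one {r : ℝ} (hr : 0 < r) : |cayley r| < 1 := by
  rw [cayley, abs_lt, lt_div_iff₀ (by positivity), div_lt_iff₀ (by positivity)]
  constructor <;> linarith

lemma cayleyWeight_nonneg {r : ℝ} (hr : 0 ≤ r) : 0 ≤ cayleyWeight H r := by
  unfold cayleyWeight; positivity

lemma cayleyWeight_le (hH : H ∈ Ioo (0 : ℝ) 1) {r : ℝ} (hr : 0 ≤ r) :
    cayleyWeight H r ≤ 2 ^ ((2 - H) / 2) := by
  unfold cayleyWeight
  have : (r + 1) ^ (-(2 - H)) ≤ 1 :=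
    Real.rpow_le_one_of_one_le_of_nonpos (by linarith) (by linarith [hH.2])
  nlinarith [Real.rpow_pos_of_pos two_pos ((2 - H) / 2)]

/-- The identity 1 - `cayley r * cayley s` = 2(r + s)/((r+1)(s+1)) reduces the kernel to the
binomial series. Its coefficients are nonnegative, so the kernel is the covariance of a series with
independent Gaussian coefficients √(`binCoeff H n`) Z_n. -/
lemma hasSum_cayley {r s : ℝ} (hr : 0 < r) (hs : 0 < s) :
    HasSum (fun n => cayleyWeight H r * cayleyWeight H s *
      (binCoeff H n * (cayley r * cayley s) ^ n)) ((r + s) ^ (-(2 - H))) := by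
  have hz : |cayley r * cayley s| < 1 := by
    rw [abs_mul]
    have h1 := abs_cayley_lt_one hr
    have h2 := abs_cayley_lt_one hs
    nlinarith [abs_nonneg (cayley r), abs_nonneg (cayley s)]
  have h1 : 1 - cayley r * cayley s = 2 * (r + s) * ((r + 1)⁻¹ * (s + 1)⁻¹) := by
    unfold cayley; field_simp; ring
  have h2 : (2 : ℝ) ^ ((2 - H) / 2) * 2 ^ ((2 - H) / 2) = 2 ^ (2 - H) := by
    rw [← Real.rpow_add two_pos]; ring_nf
  suffices h3 : (r + s) ^ (-(2 - H)) = cayleyWeight H r * cayleyWeight H s *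
      (1 / (1 - cayley r * cayley s) ^ (2 - H)) by
    rw [h3]
    exact (hasSum_binCoeff hz).mul_left (cayleyWeight H r * cayleyWeight H s)
  rw [h1, Real.mul_rpow (by positivity) (by positivity), Real.mul_rpow (by positivity) (by positivity),
    Real.mul_rpow (by positivity) (by positivity), Real.inv_rpow (by positivity),
    Real.inv_rpow (by positivity), cayleyWeight, cayleyWeight, Real.rpow_neg (by positivity),
    Real.rpow_neg (by positivity), Real.rpow_neg (by positivity), ← h2]
  have := Real.rpow_pos_of_pos (show 0 < r + 1 by positivity) (2 - H)
  have := Real.rpow_pos_of_pos (show 0 < s + 1 by positivity) (2 - H)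
  have := Real.rpow_pos_of_pos two_pos ((2 - H) / 2)
  have := Real.rpow_pos_of_pos (show 0 < r + s by positivity) (2 - H)
  field_simp

lemma cayley_mono {r s : ℝ} (hr : 0 < r) (hrs : r ≤ s) : cayley r ≤ cayley s := by
  unfold cayley
  rw [div_le_div_iff₀ (by positivity) (by linarith)]
  nlinarith

lemma pos_of_mem_uIcc {a b r : ℝ} (ha : 0 < a) (hb : 0 < b) (hr : r ∈ uIcc a b) : 0 < r :=
  lt_of_lt_of_le (lt_min ha hb) hr.1

lemma exists_cayley_bound {a b : ℝ} (ha : 0 < a) (hb : 0 < b) :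
    ∃ ρ : ℝ≥0, (ρ : ℝ≥0∞) < 1 ∧ ∀ r ∈ uIcc a b, |cayley r| ≤ ρ := by
  refine ⟨Real.toNNReal (max |cayley a| |cayley b|), ?_, fun r hr => ?_⟩
  · exact ENNReal.ofReal_lt_one.2 (max_lt (abs_cayley_lt_one ha) (abs_cayley_lt_one hb))
  · rw [Real.coe_toNNReal _ (le_max_of_le_left (abs_nonneg _))]
    have hr0 := pos_of_mem_uIcc ha hb hr
    rcases mem_uIcc.1 hr with h | h
    · exact abs_le_max_abs_abs (cayley_mono ha h.1) (cayley_mono hr0 h.2)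
    · rw [max_comm]
      exact abs_le_max_abs_abs (cayley_mono hb h.1) (cayley_mono hr0 h.2)

lemma contDiffOn_cayley : ContDiffOn ℝ ((⊤ : ℕ∞) : WithTop ℕ∞) cayley (Ioi 0) := by
  unfold cayley
  refine ContDiffOn.div (by fun_prop) (by fun_prop) fun r hr => ?_
  have : (0 : ℝ) < r := hr
  positivity

lemma contDiffOn_cayleyWeight :
    ContDiffOn ℝ ((⊤ : ℕ∞) : WithTop ℕ∞) (cayleyWeight H) (Ioi 0) := by
  unfold cayleyWeight
  refine contDiffOn_const.mul (ContDiffOn.rpow_const_of_ne (by fun_prop) fun r hr => ?_)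
  have : (0 : ℝ) < r := hr
  positivity

lemma measurable_cayley : Measurable cayley := by unfold cayley; fun_prop

lemma measurable_cayleyWeight : Measurable (cayleyWeight H) := by unfold cayleyWeight; fun_prop

/-- The function `r ↦ cayleyWeight H r * ∑ c n * cayley r ^ n`. -/
noncomputable def cayleySeries (H : ℝ) (c : ℕ → ℝ) (r : ℝ) : ℝ :=
  cayleyWeight H r * ∑' n, c n * cayley r ^ n

/-- The integral of the `n`-th term of `cayleySeries` with unit coefficient. -/
noncomputable def cayleyIntegral (H a b : ℝ) (n : ℕ) : ℝ :=
  ∫ r in a..b, cayleyWeight H r * cayley r ^ n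

lemma contDiffOn_cayleySeries {c : ℕ → ℝ}
    (hc : ∀ ρ : ℝ≥0, (ρ : ℝ≥0∞) < 1 → Summable fun n => |c n| * (ρ : ℝ) ^ n) :
    ContDiffOn ℝ ((⊤ : ℕ∞) : WithTop ℕ∞) (cayleySeries H c) (Ioi 0) := by
  refine contDiffOn_cayleyWeight.mul ((contDiffOn_tsum_mul_pow one_pos hc).comp
    contDiffOn_cayley fun r hr => ?_)
  rw [Metric.mem_eball, edist_zero_right, Real.enorm_eq_ofReal_abs]
  exact ENNReal.ofReal_lt_one.2 (abs_cayley_lt_one hr)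

lemma intervalIntegrable_cayley_term {a b : ℝ} (ha : 0 < a) (hb : 0 < b) (n : ℕ) :
    IntervalIntegrable (fun r => cayleyWeight H r * cayley r ^ n) volume a b := by
  refine ContinuousOn.intervalIntegrable ?_
  have hsub : uIcc a b ⊆ Ioi 0 := fun r hr => pos_of_mem_uIcc ha hb hr
  exact (contDiffOn_cayleyWeight.continuousOn.mono hsub).mul
    ((contDiffOn_cayley.continuousOn.mono hsub).pow n)

lemma exists_cayleyIntegral_bound (hH : H ∈ Ioo (0 : ℝ) 1) {a b : ℝ} (ha : 0 < a) (hb : 0 < b) :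
    ∃ M : ℝ, 0 ≤ M ∧ ∀ n, |cayleyIntegral H a b n| ≤ M := by
  refine ⟨2 ^ ((2 - H) / 2) * |b - a|, by positivity, fun n => ?_⟩
  change ‖∫ r in a..b, cayleyWeight H r * cayley r ^ n‖ ≤ _
  refine intervalIntegral.norm_integral_le_of_norm_le_const fun r hr => ?_
  have hr0 := pos_of_mem_uIcc ha hb (uIoc_subset_uIcc hr)
  rw [norm_mul, norm_pow, Real.norm_of_nonneg (cayleyWeight_nonneg hr0.le), Real.norm_eq_abs]
  have h1 := cayleyWeight_le hH hr0.le
  have h2 := pow_le_one₀ (n := n) (abs_nonneg _) (abs_cayley_lt_one hr0).le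
  have h3 := cayleyWeight_nonneg (H := H) hr0.le
  calc _ ≤ cayleyWeight H r * 1 := by gcongr
    _ ≤ _ := by rwa [mul_one]

lemma cayleyIntegral_sub {a b c : ℝ} (ha : 0 < a) (hb : 0 < b) (hc : 0 < c) (n : ℕ) :
    cayleyIntegral H a c n - cayleyIntegral H a b n = cayleyIntegral H b c n :=
  intervalIntegral.integral_interval_sub_left (intervalIntegrable_cayley_term ha hc n)
    (intervalIntegrable_cayley_term ha hb n)

lemma hasSum_cayleyIntegral (hH : H ∈ Ioo (0 : ℝ) 1) {c : ℕ → ℝ}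
    (hc : ∀ ρ : ℝ≥0, (ρ : ℝ≥0∞) < 1 → Summable fun n => |c n| * (ρ : ℝ) ^ n) {a b : ℝ}
    (ha : 0 < a) (hb : 0 < b) :
    HasSum (fun n => c n * cayleyIntegral H a b n) (∫ r in a..b, cayleySeries H c r) := by
  obtain ⟨ρ, hρ1, hρ⟩ := exists_cayley_bound ha hb
  have hsub : ∀ r ∈ uIoc a b, 0 < r ∧ |cayley r| ≤ ρ := fun r hr =>
    ⟨pos_of_mem_uIcc ha hb (uIoc_subset_uIcc hr), hρ r (uIoc_subset_uIcc hr)⟩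
  have hbd : ∀ n, ∀ r ∈ uIoc a b, |c n * cayley r ^ n| ≤ |c n| * (ρ : ℝ) ^ n := by
    intro n r hr
    rw [abs_mul, abs_pow]
    have := (hsub r hr).2
    gcongr
  have key := intervalIntegral.hasSum_integral_of_dominated_convergence (μ := volume) (a := a)
    (b := b) (F := fun n r => c n * (cayleyWeight H r * cayley r ^ n)) (f := cayleySeries H c)
    (fun n _ => 2 ^ ((2 - H) / 2) * (|c n| * (ρ : ℝ) ^ n)) ?_ ?_ ?_ ?_ ?_
  · simp_rw [intervalIntegral.integral_const_mul] at key
    exact key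
  · intro n
    exact (((measurable_cayleyWeight).mul (measurable_cayley.pow_const n)).const_mul
      _).aestronglyMeasurable
  · refine fun n => Eventually.of_forall fun r hr => ?_
    have h1 := cayleyWeight_nonneg (H := H) (hsub r hr).1.le
    have h2 := cayleyWeight_le hH (hsub r hr).1.le
    have h3 := hbd n r hr
    rw [show c n * (cayleyWeight H r * cayley r ^ n)
      = cayleyWeight H r * (c n * cayley r ^ n) by ring, norm_mul, Real.norm_of_nonneg h1,
      Real.norm_eq_abs]
    gcongr
  · exact Eventually.of_forall fun r _ => (hc ρ hρ1).mul_left _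
  · exact intervalIntegrable_const
  · refine Eventually.of_forall fun r hr => ?_
    have hs : Summable fun n => c n * cayley r ^ n :=
      Summable.of_norm_bounded (hc ρ hρ1) fun n => hbd n r hr
    have := hs.hasSum.mul_left (cayleyWeight H r)
    have e : (fun n => c n * (cayleyWeight H r * cayley r ^ n))
        = fun n => cayleyWeight H r * (c n * cayley r ^ n) := by
      ext n; ring
    change HasSum (fun n => c n * (cayleyWeight H r * cayley r ^ n)) _
    rw [e]
    exact this

/-- Both sides equal the double integral of (r + s)^(H-2) over r and s from a to b: termwise
integration in each variable gives the series, direct integration the closed form. -/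
lemma hasSum_binCoeff_cayleyIntegral_sq (hH : H ∈ Ioo (0 : ℝ) 1) {a b : ℝ}
    (ha : 0 < a) (hb : 0 < b) :
    HasSum (fun n => binCoeff H n * cayleyIntegral H a b n ^ 2)
      ((2 * (a + b) ^ H - (2 * a) ^ H - (2 * b) ^ H) / (H * (1 - H))) := by
  obtain ⟨M, hM0, hM⟩ := exists_cayleyIntegral_bound hH ha hb
  have hbin : ∀ ρ : ℝ≥0, (ρ : ℝ≥0∞) < 1 → Summable fun n => binCoeff H n * (ρ : ℝ) ^ n := by
    intro ρ hρ
    refine summable_binCoeff_mul_pow ?_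
    rw [abs_of_nonneg (NNReal.coe_nonneg ρ)]
    exact_mod_cast hρ
  have hc1 : ∀ ρ : ℝ≥0, (ρ : ℝ≥0∞) < 1 →
      Summable fun n => |binCoeff H n * cayleyIntegral H a b n| * (ρ : ℝ) ^ n := by
    intro ρ hρ
    refine Summable.of_nonneg_of_le (fun n => by positivity) (fun n => ?_) ((hbin ρ hρ).mul_left M)
    rw [abs_mul, abs_of_nonneg (binCoeff_nonneg hH n)]
    have := hM n
    have := binCoeff_nonneg hH n
    calc _ ≤ binCoeff H n * M * (ρ : ℝ) ^ n := by gcongr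
      _ = _ := by ring
  have h1 := hasSum_cayleyIntegral hH hc1 ha hb
  have h2 : ∀ r ∈ uIcc a b, cayleySeries H (fun n => binCoeff H n * cayleyIntegral H a b n) r
      = ∫ s in a..b, (r + s) ^ (-(2 - H)) := by
    intro r hr
    have hr0 := pos_of_mem_uIcc ha hb hr
    have hc2 : ∀ ρ : ℝ≥0, (ρ : ℝ≥0∞) < 1 →
        Summable fun n => |binCoeff H n * cayley r ^ n| * (ρ : ℝ) ^ n := by
      intro ρ hρ
      refine Summable.of_nonneg_of_le (fun n => by positivity) (fun n => ?_) (hbin ρ hρ)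
      rw [abs_mul, abs_of_nonneg (binCoeff_nonneg hH n), abs_pow]
      have h3 := pow_le_one₀ (n := n) (abs_nonneg _) (abs_cayley_lt_one hr0).le
      have := binCoeff_nonneg hH n
      calc _ ≤ binCoeff H n * 1 * (ρ : ℝ) ^ n := by gcongr
        _ = _ := by ring
    have h3 := hasSum_cayleyIntegral hH hc2 ha hb
    have h4 : (fun n => binCoeff H n * cayley r ^ n * cayleyIntegral H a b n)
        = fun n => binCoeff H n * cayleyIntegral H a b n * cayley r ^ n := by
      ext n; ring
    rw [h4] at h3
    rw [cayleySeries, h3.tsum_eq, ← intervalIntegral.integral_const_mul]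
    refine intervalIntegral.integral_congr fun s hs => ?_
    have hs0 := pos_of_mem_uIcc ha hb hs
    simp only [cayleySeries]
    rw [← (hasSum_cayley hr0 hs0).tsum_eq, ← tsum_mul_left, ← tsum_mul_left]
    refine tsum_congr fun n => ?_
    rw [mul_pow]
    ring
  have hH1 : 1 - H ≠ 0 := by linarith [hH.2]
  have hH0 : H ≠ 0 := hH.1.ne'
  have h3 : ∀ r ∈ uIcc a b, ∫ s in a..b, (r + s) ^ (-(2 - H))
      = ((r + a) ^ (H - 1) - (r + b) ^ (H - 1)) / (1 - H) := by
    intro r hr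
    have hr0 := pos_of_mem_uIcc ha hb hr
    rw [intervalIntegral.integral_comp_add_left (fun v => v ^ (-(2 - H))) r,
      integral_rpow (Or.inr ⟨by linarith [hH.1, hH.2], fun h0 => ?_⟩)]
    · rw [show -(2 - H) + 1 = H - 1 by ring, ← neg_div_neg_eq]
      congr 1 <;> ring
    · exact (pos_of_mem_uIcc (by positivity) (by positivity) h0).ne rfl
  have hint : ∀ v : ℝ, 0 < v → IntervalIntegrable (fun r => (r + v) ^ (H - 1)) volume a b := by
    intro v hv
    refine ContinuousOn.intervalIntegrable (ContinuousOn.rpow_const (by fun_prop) fun r hr => ?_)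
    exact Or.inl (add_pos (pos_of_mem_uIcc ha hb hr) hv).ne'
  have h4 : ∫ r in a..b, cayleySeries H (fun n => binCoeff H n * cayleyIntegral H a b n) r
      = (2 * (a + b) ^ H - (2 * a) ^ H - (2 * b) ^ H) / (H * (1 - H)) := by
    rw [intervalIntegral.integral_congr fun r hr => (h2 r hr).trans (h3 r hr),
      intervalIntegral.integral_div, intervalIntegral.integral_sub]
    · rw [intervalIntegral.integral_comp_add_right (fun v => v ^ (H - 1)) a,
        intervalIntegral.integral_comp_add_right (fun v => v ^ (H - 1)) b,
        integral_rpow (Or.inl (by linarith [hH.1])), integral_rpow (Or.inl (by linarith [hH.1]))]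
      rw [sub_add_cancel, ← two_mul, ← two_mul, add_comm b a]
      field_simp
      ring
    · exact hint a ha
    · exact hint b hb
  rw [h4] at h1
  convert h1 using 1
  ext n
  ring

end CayleyExpansion

/-! ### Primitives of functions smooth on (0, ∞) and integrable at 0. -/

section Primitive

variable {D : ℝ → ℝ}

lemma intervalIntegrable_of_integrableOn_Ioc (hD : ContinuousOn D (Ioi 0))
    (hint : IntegrableOn D (Ioc 0 1)) {a b : ℝ} (ha : 0 ≤ a) (hb : 0 ≤ b) :
    IntervalIntegrable D volume a b := by
  have key : ∀ t : ℝ, 0 ≤ t → IntervalIntegrable D volume 0 t := by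
    intro t ht
    rw [intervalIntegrable_iff_integrableOn_Ioc_of_le ht]
    have h1 : IntegrableOn D (Icc 1 (max 1 t)) :=
      (hD.mono fun r hr => lt_of_lt_of_le one_pos hr.1).integrableOn_Icc
    refine (hint.union h1).mono_set fun r hr => ?_
    rcases le_total r 1 with h | h
    · exact Or.inl ⟨hr.1, h⟩
    · exact Or.inr ⟨h, hr.2.trans (le_max_right _ _)⟩
  exact (key a ha).symm.trans (key b hb)

lemma continuousOn_primitive (hD : ContinuousOn D (Ioi 0)) (hint : IntegrableOn D (Ioc 0 1)) :
    ContinuousOn (fun t => ∫ r in (0 : ℝ)..t, D r) (Ici 0) := by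
  intro t ht
  have ht' : (0 : ℝ) ≤ t := ht
  have h := intervalIntegral.continuousOn_primitive_interval'
    (intervalIntegrable_of_integrableOn_Ioc hD hint le_rfl (by linarith : 0 ≤ t + 1))
    (left_mem_uIcc)
  rw [uIcc_of_le (by linarith)] at h
  refine (h t ⟨ht', by linarith⟩).mono_of_mem_nhdsWithin ?_
  rw [← Ici_inter_Iic]
  exact inter_mem_nhdsWithin _ (Iic_mem_nhds (by linarith))

lemma contDiffOn_primitive (hD : ContDiffOn ℝ ((⊤ : ℕ∞) : WithTop ℕ∞) D (Ioi 0))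
    (hint : IntegrableOn D (Ioc 0 1)) :
    ContDiffOn ℝ ((⊤ : ℕ∞) : WithTop ℕ∞) (fun t => ∫ r in (0 : ℝ)..t, D r) (Ioi 0) := by
  have hder : ∀ t ∈ Ioi (0 : ℝ), HasDerivAt (fun t => ∫ r in (0 : ℝ)..t, D r) (D t) t := by
    intro t ht
    have ht' : (0 : ℝ) < t := ht
    refine intervalIntegral.integral_hasDerivAt_right
      (intervalIntegrable_of_integrableOn_Ioc hD.continuousOn hint le_rfl ht'.le)
      (hD.continuousOn.stronglyMeasurableAtFilter isOpen_Ioi t ht)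
      (hD.continuousOn.continuousAt (Ioi_mem_nhds ht'))
  rw [contDiffOn_infty_iff_deriv_of_isOpen isOpen_Ioi]
  refine ⟨fun t ht => (hder t ht).differentiableAt.differentiableWithinAt, ?_⟩
  exact hD.congr fun t ht => (hder t ht).deriv

end Primitive

/-! ### Integrability at 0 of the derivative of the time correction. -/

section TimeCorrection

lemma norm_tsum_smul_sq {E : Type*} [NormedAddCommGroup E] [InnerProductSpace ℝ E] {Z : ℕ → E}
    (hZ : Orthonormal ℝ Z) {v : ℕ → ℝ} (hs : Summable fun n => v n • Z n) {S : ℝ}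
    (h : HasSum (fun n => v n ^ 2) S) : ‖∑' n, v n • Z n‖ ^ 2 = S := by
  have h0 : Continuous fun x : E => ‖x‖ ^ 2 := by fun_prop
  have h1 := (h0.tendsto _).comp hs.hasSum.tendsto_sum_nat
  refine tendsto_nhds_unique h1 ?_
  refine h.tendsto_sum_nat.congr fun N => ?_
  rw [Function.comp_apply, ← real_inner_self_eq_norm_sq, hZ.inner_sum]
  simp [sq]

variable {Ω : Type*} [MeasurableSpace Ω] {P : Measure Ω}

lemma Lp_ae_eq_of_tendsto {f : ℕ → Lp ℝ 2 P} {g : Lp ℝ 2 P} {h : Ω → ℝ}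
    (hfg : Tendsto f atTop (𝓝 g))
    (hfh : ∀ᵐ ω ∂P, Tendsto (fun n => f n ω) atTop (𝓝 (h ω))) : g =ᵐ[P] h := by
  obtain ⟨ns, hns, hlim⟩ := (tendstoInMeasure_of_tendsto_Lp hfg).exists_seq_tendsto_ae
  filter_upwards [hlim, hfh] with ω h1 h2
  exact tendsto_nhds_unique h1 (h2.comp hns.tendsto_atTop)

variable {H : ℝ} {Z : ℕ → Lp ℝ 2 P}

lemma norm_sqrt_smul (hZ : Orthonormal ℝ Z) (n : ℕ) :
    ‖Real.sqrt (binCoeff H n) • Z n‖ = Real.sqrt (binCoeff H n) := by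
  rw [norm_smul, hZ.1 n, mul_one, Real.norm_of_nonneg (Real.sqrt_nonneg _)]

lemma summable_norm_sqrt_smul (hH : H ∈ Ioo (0 : ℝ) 1) (hZ : Orthonormal ℝ Z) (ρ : ℝ≥0)
    (hρ : (ρ : ℝ≥0∞) < 1) :
    Summable fun n => ‖Real.sqrt (binCoeff H n) • Z n‖ * (ρ : ℝ) ^ n := by
  have hρ1 : (ρ : ℝ) < 1 := by exact_mod_cast hρ
  have hρa : |(ρ : ℝ)| < 1 := by rwa [abs_of_nonneg (NNReal.coe_nonneg ρ)]
  refine Summable.of_nonneg_of_le (fun n => by positivity) (fun n => ?_)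
    ((summable_geometric_of_lt_one ρ.2 hρ1).add (summable_binCoeff_mul_pow (H := H) hρa))
  rw [norm_sqrt_smul hZ]
  have h0 := binCoeff_nonneg hH n
  have h1 : Real.sqrt (binCoeff H n) ≤ 1 + binCoeff H n := by
    nlinarith [Real.sq_sqrt h0, sq_nonneg (Real.sqrt (binCoeff H n) - 1),
      Real.sqrt_nonneg (binCoeff H n)]
  calc _ ≤ (1 + binCoeff H n) * (ρ : ℝ) ^ n := by gcongr
    _ = _ := by rw [add_mul, one_mul]; rfl

/-- The squared norm is a partial sum of the nonnegative series `hasSum_cayley` on the diagonal s =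
r. -/
lemma norm_cayley_partial_sum_le (hH : H ∈ Ioo (0 : ℝ) 1) (hZ : Orthonormal ℝ Z) {r : ℝ}
    (hr : 0 < r) (N : ℕ) :
    ‖∑ n ∈ Finset.range N, (cayleyWeight H r * cayley r ^ n) • Real.sqrt (binCoeff H n) • Z n‖
      ≤ (r + r) ^ (-(2 - H) / 2) := by
  refine abs_le_of_sq_le_sq' ?_ (by positivity) |>.2
  simp_rw [smul_smul]
  rw [← real_inner_self_eq_norm_sq, hZ.inner_sum, ← Real.rpow_natCast ((r + r) ^ (-(2 - H) / 2)),
    ← Real.rpow_mul (by positivity)]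
  have h2 : -(2 - H) / 2 * ((2 : ℕ) : ℝ) = -(2 - H) := by push_cast; ring
  rw [h2]
  refine le_trans (le_of_eq ?_) (sum_le_hasSum (Finset.range N) ?_ (hasSum_cayley (H := H) hr hr))
  · refine Finset.sum_congr rfl fun n _ => ?_
    have := Real.mul_self_sqrt (binCoeff_nonneg hH n)
    simp only [conj_trivial, mul_pow]
    linear_combination (cayleyWeight H r * cayley r ^ n) ^ 2 * this
  · intro n _
    have h3 := binCoeff_nonneg hH n
    have h4 := cayleyWeight_nonneg (H := H) hr.le
    have h5 : 0 ≤ cayley r * cayley r := mul_self_nonneg _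
    positivity

variable [IsProbabilityMeasure P]

/-- The partial sums at r have L² norm at most (2r)^(-(2-H)/2), integrable at 0 because (2-H)/2 < 1.
Tonelli and Fatou transfer this to almost every path. -/
lemma ae_integrableOn_cayleySeries (hH : H ∈ Ioo (0 : ℝ) 1) (hZ : Orthonormal ℝ Z)
    {c : ℕ → Ω → ℝ}
    (hc1 : ∀ᵐ ω ∂P, ∀ n, c n ω = (Real.sqrt (binCoeff H n) • Z n : Lp ℝ 2 P) ω)
    (hc2 : ∀ ω, ∀ ρ : ℝ≥0, (ρ : ℝ≥0∞) < 1 → Summable fun n => |c n ω| * (ρ : ℝ) ^ n) :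
    ∀ᵐ ω ∂P, IntegrableOn (cayleySeries H fun n => c n ω) (Ioc 0 1) := by
  set f : ℕ → Lp ℝ 2 P := fun n => Real.sqrt (binCoeff H n) • Z n with hf
  -- The L² representatives `f n` are used for their joint measurability; `c n` is not assumed
  -- measurable.
  set S : ℕ → Ω → ℝ → ℝ := fun N ω r =>
    cayleyWeight H r * ∑ n ∈ Finset.range N, f n ω * cayley r ^ n with hS
  have hSm : ∀ N, Measurable (Function.uncurry (S N)) := by
    intro N
    refine (measurable_cayleyWeight.comp measurable_snd).mul
      (Finset.measurable_fun_sum _ fun n _ => ?_)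
    exact ((Lp.stronglyMeasurable (f n)).measurable.comp measurable_fst).mul
      ((measurable_cayley.comp measurable_snd).pow_const n)
  have hfix : ∀ N, ∀ r ∈ Ioc (0 : ℝ) 1,
      ∫⁻ ω, ‖S N ω r‖ₑ ∂P ≤ ENNReal.ofReal ((r + r) ^ (-(2 - H) / 2)) := by
    intro N r hr
    have hae : (∑ n ∈ Finset.range N, (cayleyWeight H r * cayley r ^ n) • f n : Lp ℝ 2 P)
        =ᵐ[P] fun ω => S N ω r := by
      have h1 : ∀ᵐ ω ∂P, ∀ n, ((cayleyWeight H r * cayley r ^ n) • f n : Lp ℝ 2 P) ω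
          = cayleyWeight H r * cayley r ^ n * f n ω := by
        rw [ae_all_iff]
        intro n
        filter_upwards [Lp.coeFn_smul (cayleyWeight H r * cayley r ^ n) (f n)] with ω h
        rw [h]; rfl
      filter_upwards [Lp.coeFn_fun_finsetSum (Finset.range N)
        (fun n => (cayleyWeight H r * cayley r ^ n) • f n), h1] with ω h2 h3
      rw [h2, hS]
      simp only [h3, Finset.mul_sum]
      exact Finset.sum_congr rfl fun n _ => by ring
    rw [← eLpNorm_one_eq_lintegral_enorm, ← eLpNorm_congr_ae hae]
    refine (eLpNorm_le_eLpNorm_of_exponent_le one_le_two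
      (Lp.aestronglyMeasurable _)).trans ?_
    rw [← Lp.enorm_def, ← ofReal_norm]
    exact ENNReal.ofReal_le_ofReal (norm_cayley_partial_sum_le hH hZ hr.1 N)
  have hfin : ∫⁻ r in Ioc (0 : ℝ) 1, ENNReal.ofReal ((r + r) ^ (-(2 - H) / 2)) < ∞ := by
    have h1 : IntervalIntegrable (fun r : ℝ => r ^ (-(2 - H) / 2)) volume 0 1 :=
      intervalIntegral.intervalIntegrable_rpow' (by linarith [hH.1])
    rw [intervalIntegrable_iff_integrableOn_Ioc_of_le zero_le_one] at h1
    refine lt_of_le_of_lt ?_ (h1.const_mul ((2 : ℝ) ^ (-(2 - H) / 2))).lintegral_lt_top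
    refine setLIntegral_mono' measurableSet_Ioc fun r hr => ?_
    rw [← two_mul, Real.mul_rpow two_pos.le hr.1.le]
  have hswap : ∀ N, ∫⁻ ω, (∫⁻ r in Ioc (0 : ℝ) 1, ‖S N ω r‖ₑ) ∂P
      ≤ ∫⁻ r in Ioc (0 : ℝ) 1, ENNReal.ofReal ((r + r) ^ (-(2 - H) / 2)) := by
    intro N
    rw [lintegral_lintegral_swap (hSm N).enorm.aemeasurable]
    exact setLIntegral_mono' measurableSet_Ioc (hfix N)
  have hfatou : ∫⁻ ω, (∫⁻ r in Ioc (0 : ℝ) 1, liminf (fun N => ‖S N ω r‖ₑ) atTop) ∂P < ∞ := by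
    refine lt_of_le_of_lt ?_ hfin
    calc _ ≤ ∫⁻ ω, liminf (fun N => ∫⁻ r in Ioc (0 : ℝ) 1, ‖S N ω r‖ₑ) atTop ∂P := by
          refine lintegral_mono fun ω => lintegral_liminf_le fun N => ?_
          exact ((hSm N).comp measurable_prodMk_left).enorm
      _ ≤ liminf (fun N => ∫⁻ ω, (∫⁻ r in Ioc (0 : ℝ) 1, ‖S N ω r‖ₑ) ∂P) atTop :=
          lintegral_liminf_le fun N => (hSm N).enorm.lintegral_prod_right'
      _ ≤ _ := by
          refine liminf_le_of_frequently_le' (Frequently.of_forall fun N => hswap N)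
  have hmeas : Measurable fun ω => ∫⁻ r in Ioc (0 : ℝ) 1, liminf (fun N => ‖S N ω r‖ₑ) atTop := by
    have : Measurable fun q : Ω × ℝ => liminf (fun N => ‖S N q.1 q.2‖ₑ) atTop :=
      Measurable.liminf fun N => (hSm N).enorm
    exact this.lintegral_prod_right'
  filter_upwards [ae_lt_top hmeas hfatou.ne, hc1] with ω h1 h2
  have hcont := (contDiffOn_cayleySeries (H := H) (hc2 ω)).continuousOn
  refine ⟨(hcont.mono Ioc_subset_Ioi_self).aestronglyMeasurable measurableSet_Ioc, ?_⟩
  refine lt_of_le_of_lt (le_of_eq ?_) h1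
  refine setLIntegral_congr_fun measurableSet_Ioc fun r hr => ?_
  have hsum : Summable fun n => c n ω * cayley r ^ n := by
    refine Summable.of_norm ((hc2 ω (Real.toNNReal |cayley r|)
      (ENNReal.ofReal_lt_one.2 (abs_cayley_lt_one hr.1))).congr fun n => ?_)
    rw [Real.coe_toNNReal _ (abs_nonneg _), norm_mul, norm_pow, Real.norm_eq_abs, Real.norm_eq_abs]
  have hlim : Tendsto (fun N => ‖S N ω r‖ₑ) atTop
      (𝓝 ‖cayleySeries H (fun n => c n ω) r‖ₑ) := by
    have h3 := (hsum.hasSum.tendsto_sum_nat.const_mul (cayleyWeight H r)).enorm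
    simp only [h2] at h3 ⊢
    simpa only [cayleySeries, hS, h2] using h3
  exact hlim.liminf_eq.symm

end TimeCorrection

/-! ### The smooth correction in time. -/

section TimeProcess

variable {H : ℝ} {Ω : Type*} [MeasurableSpace Ω] {P : Measure Ω} [IsProbabilityMeasure P]

/-- The variance of the increments of the smooth correction in time. -/
noncomputable def timeIncrement (H s t : ℝ) : ℝ :=
  (2 * (s + t) ^ H - (2 * s) ^ H - (2 * t) ^ H) / (H * (1 - H))

lemma continuous_timeIncrement (hH : H ∈ Ioo (0 : ℝ) 1) :
    Continuous fun p : ℝ × ℝ => timeIncrement H p.1 p.2 := by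
  have h := Real.continuous_rpow_const (q := H) hH.1.le
  unfold timeIncrement
  exact (((continuous_const.mul (h.comp (continuous_fst.add continuous_snd))).sub
    (h.comp (continuous_const.mul continuous_fst))).sub
    (h.comp (continuous_const.mul continuous_snd))).div_const _

lemma timeIncrement_zero (hH : H ∈ Ioo (0 : ℝ) 1) : timeIncrement H 0 0 = 0 := by
  simp [timeIncrement, Real.zero_rpow hH.1.ne']

lemma timeIncrement_comm (s t : ℝ) : timeIncrement H s t = timeIncrement H t s := by
  rw [timeIncrement, timeIncrement, add_comm s t]
  ring

/-- Continuity of `F` and its vanishing at the origin make `Y` Cauchy at 0, which extends a process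
given on (0, ∞) to time 0. -/
lemma exists_tendsto_of_norm_sub_sq {E : Type*} [NormedAddCommGroup E] [CompleteSpace E]
    {F : ℝ → ℝ → ℝ} (hF : Continuous fun p : ℝ × ℝ => F p.1 p.2) (hF0 : F 0 0 = 0)
    {Y : ℝ → E} (hY : ∀ s t, 0 < s → 0 < t → ‖Y s - Y t‖ ^ 2 = F s t)
    {a : ℕ → ℝ} (hpos : ∀ k, 0 < a k) (hlim : Tendsto a atTop (𝓝 0)) :
    ∃ l, Tendsto (fun k => Y (a k)) atTop (𝓝 l) ∧ ∀ t, 0 < t → ‖Y t - l‖ ^ 2 = F t 0 := by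
  have hcauchy : CauchySeq fun k => Y (a k) := by
    rw [cauchySeq_iff_tendsto_dist_atTop_0]
    have h2 : Tendsto (fun n : ℕ × ℕ => (a n.1, a n.2)) atTop (𝓝 ((0 : ℝ), (0 : ℝ))) := by
      rw [← prod_atTop_atTop_eq]
      exact (hlim.comp tendsto_fst).prodMk_nhds (hlim.comp tendsto_snd)
    have h1 := (hF.sqrt.tendsto (0, 0)).comp h2
    simp only [hF0, Real.sqrt_zero] at h1
    refine h1.congr fun n => ?_
    simp only [Function.comp_apply]
    rw [← hY _ _ (hpos _) (hpos _), Real.sqrt_sq (norm_nonneg _), dist_eq_norm]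
  obtain ⟨l, hl⟩ := cauchySeq_tendsto_of_complete hcauchy
  refine ⟨l, hl, fun t ht => ?_⟩
  have h1 : Tendsto (fun k => ‖Y t - Y (a k)‖ ^ 2) atTop (𝓝 (‖Y t - l‖ ^ 2)) :=
    ((tendsto_const_nhds.sub hl).norm).pow 2
  refine tendsto_nhds_unique h1 ?_
  simp only [fun k => hY t (a k) ht (hpos k)]
  exact (hF.tendsto (t, 0)).comp (tendsto_const_nhds.prodMk_nhds hlim)

/-- In the closed span of an orthonormal sequence there is a process with covariance
proportional to `t ^ H + s ^ H - (t + s) ^ H` and smooth sample paths. -/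
lemma exists_timeProcess (hH : H ∈ Ioo (0 : ℝ) 1) {Z : ℕ → Lp ℝ 2 P} (hZ : Orthonormal ℝ Z)
    (K : Submodule ℝ (Lp ℝ 2 P)) (hK : IsClosed (K : Set (Lp ℝ 2 P))) (hZK : ∀ n, Z n ∈ K) :
    ∃ (Y : ℝ≥0 → Lp ℝ 2 P) (V : ℝ → Ω → ℝ), (∀ t, Y t ∈ K) ∧
      (∀ t : ℝ≥0, Y t =ᵐ[P] V t) ∧ (∀ ω, V 0 ω = 0) ∧
      (∀ ω, ContinuousOn (fun t => V t ω) (Ici 0) ∧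
        ContDiffOn ℝ ((⊤ : ℕ∞) : WithTop ℕ∞) (fun t => V t ω) (Ioi 0)) ∧
      ∀ s t : ℝ≥0, ‖Y s - Y t‖ ^ 2 = timeIncrement H s t := by
  classical
  set f : ℕ → Lp ℝ 2 P := fun n => Real.sqrt (binCoeff H n) • Z n with hf
  obtain ⟨c, hc1, hc2, -⟩ := exists_randomPowerSeries (P := P) (r := 1) (f := f) one_pos
    (summable_norm_sqrt_smul hH hZ)
  have hint := ae_integrableOn_cayleySeries hH hZ hc1 hc2
  set G : Set Ω := {ω | IntegrableOn (cayleySeries H fun n => c n ω) (Ioc 0 1)} with hG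
  -- `D` is the path derivative, replaced by 0 on the exceptional set so that every path is regular.
  set D : Ω → ℝ → ℝ := fun ω => if ω ∈ G then cayleySeries H (fun n => c n ω) else 0 with hD
  have hDs : ∀ ω, ContDiffOn ℝ ((⊤ : ℕ∞) : WithTop ℕ∞) (D ω) (Ioi 0) := by
    intro ω
    by_cases hω : ω ∈ G
    · simp only [hD, hω, if_true]
      exact contDiffOn_cayleySeries (hc2 ω)
    · simp only [hD, hω, if_false]
      exact contDiffOn_const
  have hDi : ∀ ω, IntegrableOn (D ω) (Ioc 0 1) := by
    intro ω
    by_cases hω : ω ∈ G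
    · simp only [hD, hω, if_true]
      exact hω
    · simp only [hD, hω, if_false]
      exact integrableOn_zero
  have hDG : ∀ᵐ ω ∂P, D ω = cayleySeries H fun n => c n ω := by
    filter_upwards [hint] with ω hω
    simp only [hD, if_pos (show ω ∈ G from hω)]
  have hsn : ∀ a b : ℝ, 0 < a → 0 < b → Summable fun n => ‖cayleyIntegral H a b n • f n‖ := by
    intro a b ha hb
    have h := hasSum_cayleyIntegral hH (c := fun n => ‖f n‖) (fun ρ hρ => by
      simpa only [abs_norm] using summable_norm_sqrt_smul hH hZ ρ hρ) ha hb
    refine h.summable.abs.congr fun n => ?_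
    rw [norm_smul (cayleyIntegral H a b n) (f n), abs_mul, abs_norm, Real.norm_eq_abs, mul_comm]
  -- The primitive is based at 1 because termwise integration needs both endpoints positive. The L²
  -- limit `l` at 0 is later subtracted to move the base point to 0.
  set Y₁ : ℝ → Lp ℝ 2 P := fun t => ∑' n, cayleyIntegral H 1 t n • f n with hY₁
  have hY₁K : ∀ t, Y₁ t ∈ K := by
    intro t
    by_cases hs : Summable fun n => cayleyIntegral H 1 t n • f n
    · exact hK.mem_of_tendsto hs.hasSum (Eventually.of_forall fun s =>
        K.sum_mem fun n _ => K.smul_mem _ (K.smul_mem _ (hZK n)))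
    · simp only [hY₁, tsum_eq_zero_of_not_summable hs]
      exact K.zero_mem
  have hY₁V : ∀ t, 0 < t → Y₁ t =ᵐ[P] fun ω => ∫ r in (1 : ℝ)..t, D ω r := by
    intro t ht
    have h4 : ∀ᵐ ω ∂P, ∀ n, (cayleyIntegral H 1 t n • f n : Lp ℝ 2 P) ω
        = cayleyIntegral H 1 t n * f n ω := by
      rw [ae_all_iff]
      intro n
      filter_upwards [Lp.coeFn_smul (cayleyIntegral H 1 t n) (f n)] with ω h
      rw [h]; rfl
    filter_upwards [ae_hasSum_of_summable_norm (hsn 1 t one_pos ht), h4, hc1, hDG]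
      with ω h5 h6 h7 h8
    rw [← h5.1.tsum_eq, h8, ← (hasSum_cayleyIntegral hH (hc2 ω) one_pos ht).tsum_eq]
    refine tsum_congr fun n => ?_
    rw [h6, h7, mul_comm]
  have hY₁n : ∀ s t, 0 < s → 0 < t → ‖Y₁ s - Y₁ t‖ ^ 2 = timeIncrement H s t := by
    intro s t hs ht
    have h1 : Y₁ s - Y₁ t
        = ∑' n, (cayleyIntegral H t s n * Real.sqrt (binCoeff H n)) • Z n := by
      rw [hY₁]
      simp only []
      rw [← (hsn 1 s one_pos hs).of_norm.tsum_sub (hsn 1 t one_pos ht).of_norm]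
      refine tsum_congr fun n => ?_
      rw [← sub_smul, cayleyIntegral_sub one_pos ht hs, hf, smul_smul]
    rw [h1]
    refine norm_tsum_smul_sq hZ ?_ ?_
    · refine (hsn t s ht hs).of_norm.congr fun n => ?_
      rw [hf, smul_smul]
    · rw [timeIncrement_comm]
      have h2 : (fun n => (cayleyIntegral H t s n * Real.sqrt (binCoeff H n)) ^ 2)
          = fun n => binCoeff H n * cayleyIntegral H t s n ^ 2 := by
        ext n
        rw [mul_pow, Real.sq_sqrt (binCoeff_nonneg hH n), mul_comm]
      rw [h2]
      exact hasSum_binCoeff_cayleyIntegral_sq hH ht hs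
  set sq : ℕ → ℝ := fun k => 1 / ((k : ℝ) + 1) with hsq
  have hsq0 : ∀ k, 0 < sq k := fun k => by simp only [hsq]; positivity
  have hsqlim : Tendsto sq atTop (𝓝 0) := tendsto_one_div_add_atTop_nhds_zero_nat
  obtain ⟨l, hl, hYl⟩ := exists_tendsto_of_norm_sub_sq (continuous_timeIncrement hH)
    (timeIncrement_zero hH) hY₁n hsq0 hsqlim
  have hlK : l ∈ K := hK.mem_of_tendsto hl (Eventually.of_forall fun k => hY₁K _)
  have hlV : l =ᵐ[P] fun ω => ∫ r in (1 : ℝ)..0, D ω r := by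
    refine Lp_ae_eq_of_tendsto hl ?_
    have h1 : ∀ᵐ ω ∂P, ∀ k, Y₁ (sq k) ω = ∫ r in (1 : ℝ)..(sq k), D ω r := by
      rw [ae_all_iff]
      exact fun k => hY₁V _ (hsq0 k)
    filter_upwards [h1] with ω h2
    simp only [h2]
    have hi : ∀ a b : ℝ, 0 ≤ a → 0 ≤ b → IntervalIntegrable (D ω) volume a b := fun a b ha hb =>
      intervalIntegrable_of_integrableOn_Ioc (hDs ω).continuousOn (hDi ω) ha hb
    have h3 : ∀ t : ℝ, 0 ≤ t → ∫ r in (1 : ℝ)..t, D ω r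
        = (∫ r in (1 : ℝ)..0, D ω r) + ∫ r in (0 : ℝ)..t, D ω r := fun t ht =>
      (intervalIntegral.integral_add_adjacent_intervals (hi 1 0 zero_le_one le_rfl)
        (hi 0 t le_rfl ht)).symm
    simp only [fun k => h3 (sq k) (hsq0 k).le]
    have h4 := (continuousOn_primitive (hDs ω).continuousOn (hDi ω)) 0 (mem_Ici.2 le_rfl)
    have h5 : Tendsto sq atTop (𝓝[Ici 0] 0) :=
      tendsto_nhdsWithin_iff.2 ⟨hsqlim, Eventually.of_forall fun k => (hsq0 k).le⟩
    have h6 := (h4.tendsto.comp h5).const_add (∫ r in (1 : ℝ)..0, D ω r)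
    simpa using h6
  refine ⟨fun t => if 0 < t then Y₁ t - l else 0, fun t ω => ∫ r in (0 : ℝ)..t, D ω r,
    fun t => ?_, fun t => ?_, fun ω => intervalIntegral.integral_same, fun ω =>
    ⟨continuousOn_primitive (hDs ω).continuousOn (hDi ω), contDiffOn_primitive (hDs ω) (hDi ω)⟩,
    fun s t => ?_⟩
  · simp only []
    split_ifs
    · exact K.sub_mem (hY₁K _) hlK
    · exact K.zero_mem
  · rcases eq_zero_or_pos t with rfl | ht
    · simp only [lt_irrefl, if_false, NNReal.coe_zero, intervalIntegral.integral_same]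
      exact Lp.coeFn_zero _ _ _
    · simp only [ht, if_true]
      filter_upwards [Lp.coeFn_sub (Y₁ t) l, hY₁V t ht, hlV] with ω h1 h2 h3
      rw [h1, Pi.sub_apply, h2, h3]
      have hi : ∀ a b : ℝ, 0 ≤ a → 0 ≤ b → IntervalIntegrable (D ω) volume a b := fun a b ha hb =>
        intervalIntegrable_of_integrableOn_Ioc (hDs ω).continuousOn (hDi ω) ha hb
      exact intervalIntegral.integral_interval_sub_left (hi 1 t zero_le_one t.2)
        (hi 1 0 zero_le_one le_rfl)
  · rcases eq_zero_or_pos s with rfl | hs <;> rcases eq_zero_or_pos t with rfl | ht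
    · simp [timeIncrement_zero hH]
    · simp only [lt_irrefl, if_false, ht, if_true, NNReal.coe_zero, zero_sub, norm_neg]
      rw [timeIncrement_comm]
      exact hYl t ht
    · simp only [lt_irrefl, if_false, hs, if_true, NNReal.coe_zero, sub_zero]
      exact hYl s hs
    · simp only [hs, ht, if_true, sub_sub_sub_cancel_right]
      exact hY₁n s t hs ht

end TimeProcess

/-! ### Matching the constants in time. -/

section MainLemmas

variable {H κ : ℝ} {Ω : Type*} [MeasurableSpace Ω] {P : Measure Ω} [IsProbabilityMeasure P]
  {W : 𝓓(halfPlane, ℝ) → Ω → ℝ} {u : ℝ≥0 → ℝ → Ω → ℝ}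

lemma covConst_pos (hH : H ∈ Ioo (0 : ℝ) 1) (hκ : 0 < κ) : 0 < covConst H κ := by
  have h1 := c1_pos hH
  have h2 := Real.Gamma_pos_of_pos (show 0 < 1 - H by linarith [hH.2])
  have h3 := hH.1
  unfold covConst
  positivity

/-- Reflection formula for Γ(1-H), together with Γ(2H+1) = 2H Γ(2H). -/
lemma C1_sq (hH : H ∈ Ioo (0 : ℝ) 1) (hκ : 0 < κ) : C1 H κ ^ 2 = 2 * covConst H κ := by
  have h0 := hH.1
  have h1 := Real.Gamma_pos_of_pos (show 0 < 2 * H by linarith)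
  have h2 := Real.Gamma_pos_of_pos h0
  have h3 := Real.Gamma_mul_Gamma_one_sub H
  rw [mul_comm Real.pi H] at h3
  have hs : 0 < Real.sin (H * Real.pi) :=
    Real.sin_pos_of_pos_of_lt_pi (by positivity) (by nlinarith [hH.2, Real.pi_pos])
  have h4 : Real.Gamma (1 - H) = Real.pi / Real.sin (H * Real.pi) / Real.Gamma H := by
    rw [← h3]; field_simp
  have h5 : (κ / 2) ^ (H - 1) = 2 ^ (1 - H) / κ ^ (1 - H) := by
    rw [show H - 1 = -(1 - H) by ring, Real.rpow_neg (by positivity),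
      Real.div_rpow hκ.le two_pos.le, inv_div]
  unfold C1 covConst c1
  rw [Real.sq_sqrt (by positivity), h4, h5, Real.Gamma_add_one (by positivity)]
  have := Real.pi_pos
  field_simp

omit [IsProbabilityMeasure P] in
lemma IsStochasticConvolution.inner_time (hu : IsStochasticConvolution H κ W P u)
    (hH : H ∈ Ioo (0 : ℝ) 1) (hκ : 0 < κ) (hW : IsFractionalNoise H W P) (s t : ℝ≥0) (x : ℝ) :
    inner ℝ (hu.toL2 (s, x)) (hu.toL2 (t, x))
      = covConst H κ * (((s : ℝ) + t) ^ H - |(s : ℝ) - t| ^ H) := by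
  rw [hu.inner_toL2 hW]
  exact inner_convKernel_time hH hκ s.2 t.2 x _ _

omit [IsProbabilityMeasure P] in
-- The subtracted term is what the independent correction has to supply.
lemma IsStochasticConvolution.norm_sub_time (hu : IsStochasticConvolution H κ W P u)
    (hH : H ∈ Ioo (0 : ℝ) 1) (hκ : 0 < κ) (hW : IsFractionalNoise H W P) (s t : ℝ≥0) (x : ℝ) :
    ‖hu.toL2 (s, x) - hu.toL2 (t, x)‖ ^ 2 = 2 * covConst H κ * |(s : ℝ) - t| ^ H
      - covConst H κ * H * (1 - H) * timeIncrement H s t := by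
  have hH0 := hH.1.ne'
  have hH1 : 1 - H ≠ 0 := by linarith [hH.2]
  rw [@norm_sub_sq_real, ← real_inner_self_eq_norm_sq, ← real_inner_self_eq_norm_sq,
    hu.inner_time hH hκ hW, hu.inner_time hH hκ hW, hu.inner_time hH hκ hW, timeIncrement]
  simp only [sub_self, abs_zero, Real.zero_rpow hH0, sub_zero, ← two_mul]
  field_simp
  ring

/-- An orthogonal process with smooth sample paths whose addition turns the stochastic
convolution at the point `x` into a multiple of fractional Brownian motion. -/
lemma exists_timeCorrection (hH : H ∈ Ioo (0 : ℝ) 1) (hκ : 0 < κ)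
    (hW : IsFractionalNoise H W P) (hu : IsStochasticConvolution H κ W P u) (x : ℝ) :
    ∃ (Y : ℝ≥0 → Lp ℝ 2 P) (V : ℝ → Ω → ℝ), (∀ t, Y t ∈ gaussianSpace W P) ∧
      (∀ t : ℝ≥0, Y t =ᵐ[P] V t) ∧ (∀ ω, V 0 ω = 0) ∧
      (∀ ω, ContinuousOn (fun t => V t ω) (Ici 0) ∧
        ContDiffOn ℝ ((⊤ : ℕ∞) : WithTop ℕ∞) (fun t => V t ω) (Ioi 0)) ∧
      ∀ s t : ℝ≥0, ‖(hu.toL2 (s, x) + Y s) - (hu.toL2 (t, x) + Y t)‖ ^ 2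
        = C1 H κ ^ 2 * |(s : ℝ) - t| ^ H := by
  obtain ⟨Z, hZ, hZW, hZu⟩ := exists_orthonormal_seq_time hH hκ hW hu x
  set K : Submodule ℝ (Lp ℝ 2 P) :=
    gaussianSpace W P ⊓ (Submodule.span ℝ (range fun t : ℝ≥0 => hu.toL2 (t, x)))ᗮ with hK
  have hKc : IsClosed (K : Set (Lp ℝ 2 P)) :=
    (isClosed_gaussianSpace W).inter (Submodule.isClosed_orthogonal _)
  have hZK : ∀ n, Z n ∈ K := by
    refine fun n => ⟨hZW n, (Submodule.mem_orthogonal' _ _).2 fun v hv => ?_⟩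
    induction hv using Submodule.span_induction with
    | mem v h => obtain ⟨x, rfl⟩ := h; exact hZu n x
    | zero => exact inner_zero_right _
    | add a b _ _ ha hb => rw [inner_add_right, ha, hb, add_zero]
    | smul c a _ ha => rw [real_inner_smul_right, ha, mul_zero]
  obtain ⟨Y, V, hYK, hYV, hV0, hVs, hYn⟩ := exists_timeProcess hH hZ K hKc hZK
  have hl : 0 ≤ covConst H κ * H * (1 - H) := by
    have h1 := (covConst_pos hH hκ).le
    have h2 := hH.1.le
    have h3 : 0 ≤ 1 - H := by linarith [hH.2]
    positivity
  -- With this scaling the variance of the correction cancels the defect in `norm_sub_time`.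
  set q := Real.sqrt (covConst H κ * H * (1 - H)) with hq
  refine ⟨fun t => q • Y t, fun t ω => q * V t ω, fun t => Submodule.smul_mem _ _ (hYK t).1,
    fun t => ?_, fun ω => by simp [hV0], fun ω => ⟨continuousOn_const.mul (hVs ω).1,
    contDiffOn_const.mul (hVs ω).2⟩, fun s t => ?_⟩
  · filter_upwards [Lp.coeFn_smul q (Y t), hYV t] with ω h1 h2
    rw [h1, Pi.smul_apply, h2, smul_eq_mul]
  · have horth : inner ℝ (hu.toL2 (s, x) - hu.toL2 (t, x)) (q • (Y s - Y t)) = 0 := by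
      refine (Submodule.mem_orthogonal _ _).1
        (K.smul_mem q (K.sub_mem (hYK s) (hYK t))).2 _ ?_
      exact Submodule.sub_mem _ (Submodule.subset_span (mem_range_self s))
        (Submodule.subset_span (mem_range_self t))
    rw [add_sub_add_comm, ← smul_sub, @norm_add_sq_real, horth, norm_smul, mul_pow, hYn,
      Real.norm_eq_abs, sq_abs, hq, Real.sq_sqrt hl, hu.norm_sub_time hH hκ hW, C1_sq hH hκ]
    ring

omit [IsProbabilityMeasure P] in
lemma integral_abs_sub_sq {f g : Ω → ℝ} {Yf Yg : Lp ℝ 2 P} (hf : Yf =ᵐ[P] f) (hg : Yg =ᵐ[P] g) :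
    ∫ ω, |f ω - g ω| ^ 2 ∂P = ‖Yf - Yg‖ ^ 2 := by
  rw [← integral_sq_eq_norm_sq]
  refine integral_congr_ae ?_
  filter_upwards [hf, hg, Lp.coeFn_sub Yf Yg] with ω h1 h2 h3
  rw [h3, Pi.sub_apply, h1, h2, sq_abs]

end MainLemmas

end FracHeat

/-! ### Assembly of the two decompositions. -/

open FracHeat in
theorem theorem1 {Ω : Type*} [MeasurableSpace Ω] (P : Measure Ω) [IsProbabilityMeasure P]
    (H κ : ℝ) (hH : H ∈ Ioo (0 : ℝ) 1) (hκ : 0 < κ)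
    (W : 𝓓(FracHeat.halfPlane, ℝ) → Ω → ℝ) (hW : FracHeat.IsFractionalNoise H W P)
    (u : ℝ≥0 → ℝ → Ω → ℝ) (hu : FracHeat.IsStochasticConvolution H κ W P u) :
    (∀ x : ℝ, ∃ X : ℝ≥0 → Ω → ℝ,
      FracHeat.IsFBM (H / 2) X P ∧
      IsGaussianProcess (fun (t : ℝ≥0) ω => u t x ω - FracHeat.C1 H κ * X t ω) P ∧
      (∀ t : ℝ≥0, ∫ ω, (u t x ω - FracHeat.C1 H κ * X t ω) ∂P = 0) ∧
      ∃ V : ℝ → Ω → ℝ,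
        (∀ t : ℝ≥0, ∀ᵐ ω ∂P, V (t : ℝ) ω = u t x ω - FracHeat.C1 H κ * X t ω) ∧
        ∀ ω, ContinuousOn (fun t => V t ω) (Ici 0) ∧
          ContDiffOn ℝ ((⊤ : ℕ∞) : WithTop ℕ∞) (fun t => V t ω) (Ioi 0)) ∧
    (∀ t : ℝ≥0, 0 < t → ∃ B : ℝ → Ω → ℝ,
      FracHeat.IsTwoSidedFBM H B P ∧
      IsGaussianProcess (fun (x : ℝ) ω => u t x ω - κ ^ (-(1 / 2) : ℝ) * B x ω) P ∧
      ∃ V : ℝ → Ω → ℝ,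
        (∀ x : ℝ, ∀ᵐ ω ∂P, V x ω = u t x ω - κ ^ (-(1 / 2) : ℝ) * B x ω) ∧
        ∀ ω, ContDiff ℝ ((⊤ : ℕ∞) : WithTop ℕ∞) (fun x => V x ω)) := by
  have hG := hW.gaussian
  have hW0 := hW.mean_zero
  constructor
  · intro x
    obtain ⟨Y, V, hYW, hYV, hV0, hVs, hYn⟩ := exists_timeCorrection hH hκ hW hu x
    have hC : 0 < C1 H κ := by
      have h1 := C1_sq hH hκ
      have h2 := covConst_pos hH hκ
      have h3 : 0 ≤ C1 H κ := Real.sqrt_nonneg _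
      rcases h3.lt_or_eq with h | h
      · exact h
      · rw [← h] at h1; linarith
    -- The fBm is (u + Y)/C1, so the remainder is exactly -Y.
    have hXmem : ∀ t : ℝ≥0, (C1 H κ)⁻¹ • (hu.toL2 (t, x) + Y t) ∈ gaussianSpace W P := fun t =>
      Submodule.smul_mem _ _ (Submodule.add_mem _ (hu.toL2_mem hW _) (hYW t))
    have hX : ∀ t : ℝ≥0, ((C1 H κ)⁻¹ • (hu.toL2 (t, x) + Y t) : Lp ℝ 2 P)
        =ᵐ[P] fun ω => (C1 H κ)⁻¹ * (u t x ω + V t ω) := by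
      intro t
      filter_upwards [Lp.coeFn_smul (C1 H κ)⁻¹ (hu.toL2 (t, x) + Y t),
        Lp.coeFn_add (hu.toL2 (t, x)) (Y t), hu.coeFn_toL2 (t, x), hYV t] with ω h1 h2 h3 h4
      rw [h1, Pi.smul_apply, h2, Pi.add_apply, h3, h4, smul_eq_mul]
    have hR : ∀ t : ℝ≥0, (-(Y t) : Lp ℝ 2 P)
        =ᵐ[P] fun ω => u t x ω - C1 H κ * ((C1 H κ)⁻¹ * (u t x ω + V t ω)) := by
      intro t
      filter_upwards [Lp.coeFn_neg (Y t), hYV t] with ω h1 h2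
      rw [h1, Pi.neg_apply, h2, mul_inv_cancel_left₀ hC.ne']
      ring
    have hRmem : ∀ t, -(Y t) ∈ gaussianSpace W P := fun t => Submodule.neg_mem _ (hYW t)
    refine ⟨fun t ω => (C1 H κ)⁻¹ * (u t x ω + V t ω), ⟨?_, fun t => ?_, ?_, fun s t => ?_⟩,
      ?_, fun t => ?_, fun t ω => -V t ω, fun t => ?_, fun ω => ⟨(hVs ω).1.neg, (hVs ω).2.neg⟩⟩
    · exact isGaussianProcess_of_mem_gaussianSpace hG hW0 _ hXmem hX
    · rw [← integral_congr_ae (hX t)]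
      exact integral_eq_zero_of_mem_gaussianSpace hW0 (hXmem t)
    · have h0 : hu.toL2 (0, x) = 0 := by
        rw [← norm_eq_zero, ← sq_eq_zero_iff, ← real_inner_self_eq_norm_sq,
          hu.inner_time hH hκ hW]
        simp
      have h1 := hu.coeFn_toL2 (0, x)
      rw [h0] at h1
      filter_upwards [h1, Lp.coeFn_zero ℝ 2 P] with ω h2 h3
      rw [← h2, h3]
      simp [hV0]
    · rw [integral_abs_sub_sq (hX t) (hX s), ← smul_sub, norm_smul, mul_pow, hYn, norm_inv,
        Real.norm_of_nonneg hC.le, inv_pow, inv_mul_cancel_left₀ (by positivity)]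
      congr 1
      ring
    · exact isGaussianProcess_of_mem_gaussianSpace hG hW0 _ hRmem hR
    · rw [← integral_congr_ae (hR t)]
      exact integral_eq_zero_of_mem_gaussianSpace hW0 (hRmem t)
    · refine Eventually.of_forall fun ω => ?_
      rw [mul_inv_cancel_left₀ hC.ne']
      ring
  · intro t ht
    obtain ⟨Y, V, hYW, hYV, hV0, hVs, hYn⟩ := exists_spaceCorrection hH hκ hW hu ht
    have hκs : κ ^ (-(1 / 2) : ℝ) * Real.sqrt κ = 1 := by
      rw [Real.sqrt_eq_rpow, ← Real.rpow_add hκ]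
      simp
    -- Only the increments of u + Y are those of fBm, so the value at 0 is subtracted; the remainder
    -- becomes u_t(0) - Y, the first term being constant in `x`.
    have hBmem : ∀ x : ℝ, Real.sqrt κ • ((hu.toL2 (t, x) + Y x) - hu.toL2 (t, 0))
        ∈ gaussianSpace W P := fun x => Submodule.smul_mem _ _ (Submodule.sub_mem _
      (Submodule.add_mem _ (hu.toL2_mem hW _) (hYW x)) (hu.toL2_mem hW _))
    have hB : ∀ x : ℝ, (Real.sqrt κ • ((hu.toL2 (t, x) + Y x) - hu.toL2 (t, 0)) : Lp ℝ 2 P)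
        =ᵐ[P] fun ω => Real.sqrt κ * ((u t x ω + V x ω) - u t 0 ω) := by
      intro x
      filter_upwards [Lp.coeFn_smul (Real.sqrt κ) ((hu.toL2 (t, x) + Y x) - hu.toL2 (t, 0)),
        Lp.coeFn_sub (hu.toL2 (t, x) + Y x) (hu.toL2 (t, 0)),
        Lp.coeFn_add (hu.toL2 (t, x)) (Y x), hu.coeFn_toL2 (t, x), hu.coeFn_toL2 (t, 0), hYV x]
        with ω h1 h2 h3 h4 h5 h6
      rw [h1, Pi.smul_apply, h2, Pi.sub_apply, h3, Pi.add_apply, h4, h5, h6, smul_eq_mul]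
    have hcancel : ∀ x ω, u t 0 ω - V x ω = u t x ω
        - κ ^ (-(1 / 2) : ℝ) * (Real.sqrt κ * ((u t x ω + V x ω) - u t 0 ω)) := by
      intro x ω
      rw [← mul_assoc, hκs]
      ring
    refine ⟨fun x ω => Real.sqrt κ * ((u t x ω + V x ω) - u t 0 ω),
      ⟨?_, fun x => ?_, ?_, fun x y => ?_⟩, ?_, fun x ω => u t 0 ω - V x ω, fun x => ?_,
      fun ω => contDiff_const.sub (hVs ω)⟩
    · exact isGaussianProcess_of_mem_gaussianSpace hG hW0 _ hBmem hB
    · rw [← integral_congr_ae (hB x)]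
      exact integral_eq_zero_of_mem_gaussianSpace hW0 (hBmem x)
    · exact Eventually.of_forall fun ω => by simp [hV0]
    · rw [integral_abs_sub_sq (hB x) (hB y), ← smul_sub, sub_sub_sub_cancel_right, norm_smul,
        mul_pow, hYn, Real.norm_of_nonneg (Real.sqrt_nonneg _), Real.sq_sqrt hκ.le,
        mul_inv_cancel_left₀ hκ.ne']
    · refine isGaussianProcess_of_mem_gaussianSpace hG hW0
        (fun x => hu.toL2 (t, 0) - Y x)
        (fun x => Submodule.sub_mem _ (hu.toL2_mem hW _) (hYW x)) fun x => ?_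
      filter_upwards [Lp.coeFn_sub (hu.toL2 (t, 0)) (Y x), hu.coeFn_toL2 (t, 0), hYV x]
        with ω h1 h2 h3
      rw [h1, Pi.sub_apply, h2, h3]
      exact hcancel x ω
    · exact Eventually.of_forall fun ω => hcancel x ω
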